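/- **Proposition 6.5 (A form of commutativity).** *Setting.* Let $Mod$ be an abelian category with enough projectives and with a monoidal structure $(\otimes,\mathbf 1)$ that is additive in both variables and such that $P\otimes Q$ is projective whenever $P$ and $Q$ are (for instance $R$-modules over a commutative ring $R$, or $R$-modules with an action of a group $G$, with $\mathbf 1=R$). Assume that $\otimes$ is commutative in the sense that there are isomorphisms $\mathrm{swap}=\mathrm{swap}_{X,Y}\colon X\otimes Y\to Y\otimes X$, natural in $X$ and $Y$. *Completed Ext.* Let $A_\bullet\to A$ be a projective resolution. For $n\in\mathbb Z$ put $\mathrm{Ext}^n(A,M)=H^n(\mathrm{Hom}(A_\bullet,M))$ (zero for $n<0$). The connecting homomorphism $\delta$ of $0\to M''\to M'\to M\to 0$ lifts a cocycle $A_n\to M$ to a map $u\colon A_n\to M'$ and takes $(-1)^{n+1}u\circ a_{n+1}$, where $a_{n+1}\colon A_{n+1}\to A_n$, as a cocycle with values in $M''$. For a projective resolution $B_\bullet\to B$ with syzygies $\widetilde B_0=B$ and $0\to\widetilde B_{k+1}\to B_k\to\widetilde B_k\to0$ put $$\widehat{\mathrm{Ext}}^n(A,B)=\varinjlim_k\big(\mathrm{Ext}^{n+k}(A,\widetilde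 B_k),\delta\big),$$ which is functorial in $A$ and $B$ through lifts to the resolutions. *External products.* Let $A_\bullet$, $C_\bullet$ be projective resolutions of $A$, $C$ such that $A_\bullet\otimes C_\bullet$, with the tensor product of the augmentations, is a projective resolution of $A\otimes C$. Let $B_\bullet$, $E_\bullet$ be projective resolutions of $B$, $E$ such that for all their syzygies $F\in\{\widetilde B_k,\widetilde E_k\mid k\ge0\}$ the functors $-\otimes F$ and $F\otimes-$ are exact and preserve projectives. The external product $\mathrm{Ext}^i(A,M)\otimes\mathrm{Ext}^j(C,N)\to\mathrm{Ext}^{i+j}(A\otimes C,M\otimes N)$ sends the classes of $u$ and $v$ to the class of $(-1)^{ij}(u\otimes v)\circ p$, where $p$ is the projection $(A_\bullet\otimes C_\bullet)_{i+j}\to A_i\otimes C_j$. Consider the staircase path $(p,q)=(0,0),(1,0),(1,1),(2,1),(2,2),\dots$ The external products form a map from the direct system of the groups $\mathrm{Ext}^{m+p}(A,\widetilde B_p)\otimes\mathrm{Ext}^{n+q}(C,\widetilde E_q)$ along this path, with transition maps $\delta\otimes\mathrm{id}$ (when $p$ increases) and $(-1)^{m+p}\,\mathrm{id}\otimes\delta$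 (when $q$ increases), to the direct system of the groups $\mathrm{Ext}^{m+n+p+q}(A\otimes C,\widetilde B_p\otimes\widetilde E_q)$ with the connecting homomorphisms $\delta$ as transition maps. The objects $\widetilde B_p\otimes\widetilde E_q$ along the path are the syzygies of a projective resolution of $B\otimes E$, so the limit of the second system is $\widehat{\mathrm{Ext}}^{m+n}(A\otimes C,B\otimes E)$. The limit of the first is identified with $\widehat{\mathrm{Ext}}^m(A,B)\otimes\widehat{\mathrm{Ext}}^n(C,E)$ by the canonical maps of the terms, each multiplied by the product of the signs of the preceding transition maps (this product is $1$ at $(k,k)$ when $4\mid k$). In the limit one obtains $$\vee\colon\widehat{\mathrm{Ext}}^m(A,B)\otimes\widehat{\mathrm{Ext}}^n(C,E)\to\widehat{\mathrm{Ext}}^{m+n}(A\otimes C,B\otimes E)\qquad(m,n\in\mathbb Z).$$ *Statement for external products.* In this situation $C_\bullet\otimes A_\bullet$ is a projective resolution of $C\otimes A$, and for all $m,n\in\mathbb Z$ the following hold. 1. For every $k\ge0$ the diagram $$\begin{array}{ccc} \mathrm{Ext}^{m+k}(A,\widetilde B_k)\otimes\mathrm{Ext}^{n+k}(C,\widetilde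 E_k)&\xrightarrow{(-1)^{(m+k)(n+k)}\mathrm{swap}}&\mathrm{Ext}^{n+k}(C,\widetilde E_k)\otimes\mathrm{Ext}^{m+k}(A,\widetilde B_k)\\ {\scriptstyle\delta\otimes\mathrm{id}}\downarrow&&\downarrow{\scriptstyle(-1)^{n+k}\mathrm{id}\otimes\delta}\\ \mathrm{Ext}^{m+k+1}(A,\widetilde B_{k+1})\otimes\mathrm{Ext}^{n+k}(C,\widetilde E_k)&\xrightarrow{(-1)^{(m+k+1)(n+k)}\mathrm{swap}}&\mathrm{Ext}^{n+k}(C,\widetilde E_k)\otimes\mathrm{Ext}^{m+k+1}(A,\widetilde B_{k+1})\\ {\scriptstyle(-1)^{m+k+1}\mathrm{id}\otimes\delta}\downarrow&&\downarrow{\scriptstyle\delta\otimes\mathrm{id}}\\ \mathrm{Ext}^{m+k+1}(A,\widetilde B_{k+1})\otimes\mathrm{Ext}^{n+k+1}(C,\widetilde E_{k+1})&\xrightarrow{(-1)^{(m+k+1)(n+k+1)}\mathrm{swap}}&\mathrm{Ext}^{n+k+1}(C,\widetilde E_{k+1})\otimes\mathrm{Ext}^{m+k+1}(A,\widetilde B_{k+1})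 \end{array}$$ commutes, where $\mathrm{swap}$ here is the flip $x\otimes y\mapsto y\otimes x$ of tensor products of abelian groups. 2. Both vertical systems map to the tensor products of the completed Ext-groups by the canonical maps multiplied with the accumulated signs, as above, and in the direct limit the horizontal maps induce a homomorphism $$\widehat{\mathrm{swap}}\colon\widehat{\mathrm{Ext}}^m(A,B)\otimes\widehat{\mathrm{Ext}}^n(C,E)\to\widehat{\mathrm{Ext}}^n(C,E)\otimes\widehat{\mathrm{Ext}}^m(A,B).$$ If $4\mid k$, $x\in\mathrm{Ext}^{m+k}(A,\widetilde B_k)$, $y\in\mathrm{Ext}^{n+k}(C,\widetilde E_k)$ have images $\hat x$, $\hat y$ in completed Ext, then $\widehat{\mathrm{swap}}(\hat x\otimes\hat y)=(-1)^{(m+k)(n+k)}\,\hat y\otimes\hat x$. 3. As homomorphisms $\widehat{\mathrm{Ext}}^m(A,B)\otimes\widehat{\mathrm{Ext}}^n(C,E)\to\widehat{\mathrm{Ext}}^{m+n}(C\otimes A,E\otimes B)$, $$\widehat{\mathrm{Ext}}^{m+n}\big(\mathrm{swap}_{A,C}^{-1},\mathrm{swap}_{B,E}\big)\circ\vee=\vee\circ\widehat{\mathrm{swap}}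 .$$ *Statement for cup products.* Let moreover $\mathrm{Res}\colon Mod\to\mathcal D$ be an exact, faithful, additive and strong monoidal functor to an abelian category $\mathcal D$ with a monoidal structure that is additive in both variables (for instance the functor that forgets the action of $G$). Assume that $\mathrm{Res}$ preserves projectives and that $\mathrm{Res}(\mathbf 1)$ is projective. Let $R_\bullet$ be a projective resolution of $\mathbf 1$. Then $R_\bullet\otimes R_\bullet$ is a projective resolution of $\mathbf 1\otimes\mathbf 1$. Write $\widehat H^n(M)=\widehat{\mathrm{Ext}}^n(\mathbf 1,M)$, let $M$, $N$ be objects with projective resolutions that satisfy the condition on $B_\bullet$, $E_\bullet$ above, and let the cup product $\smile\colon\widehat H^m(M)\otimes\widehat H^n(N)\to\widehat H^{m+n}(M\otimes N)$ be the external product followed by the isomorphism that $\lambda\colon\mathbf 1\otimes\mathbf 1\cong\mathbf 1$ induces. Then for all $m,n\in\mathbb Z$, with $\rho=\lambda\circ\mathrm{swap}_{\mathbf 1,\mathbf 1}^{-1}\circ\lambda^{-1}\colon\mathbf 1\to\mathbf 1$, $$\widehat{\mathrm{Ext}}^{m+n}(\rho,\mathrm{swap}_{M,N})\circ\smile=\smile\circ\widehat{\mathrm{swap}}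 .$$ In particular, if $\mathrm{swap}_{\mathbf 1,\mathbf 1}=\mathrm{id}$, as for the flip $a\otimes b\mapsto b\otimes a$ of modules, then $\widehat H^{m+n}(\mathrm{swap}_{M,N})\circ\smile=\smile\circ\widehat{\mathrm{swap}}$. -/

import Mathlib

open CategoryTheory Limits MonoidalCategory
open scoped TensorProduct ZeroObject

universe v u v₂ u₂

namespace CompletedExt

noncomputable section

set_option linter.unusedSectionVars false
set_option linter.unusedVariables false

section Ext

variable {C : Type u} [Category.{v} C] [Abelian C]

/-- The terms of the extension by zero of an `ℕ`-indexed chain complex to all integers. -/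
def extX (K : ChainComplex C ℕ) : ℤ → C
  | .ofNat n => K.X n
  | .negSucc _ => 0

/-- The differentials of the extension by zero. -/
def extD (K : ChainComplex C ℕ) : ∀ i j : ℤ, extX K i ⟶ extX K j
  | .ofNat a, .ofNat b => K.d a b
  | .ofNat _, .negSucc _ => 0
  | .negSucc _, _ => 0

/-- The extension by zero of an `ℕ`-indexed chain complex to all integers. -/
def extendZ (K : ChainComplex C ℕ) : ChainComplex C ℤ where
  X := extX K
  d := extD K
  shape i j h := by
    match i, j with
    | .ofNat a, .ofNat b =>
      refine K.shape a b fun h' => h ?_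
      simp only [ComplexShape.down_Rel] at h' ⊢
      subst h'; rfl
    | .ofNat _, .negSucc _ => rfl
    | .negSucc _, _ => rfl
  d_comp_d' i j k _ _ := by
    match i, j, k with
    | .ofNat a, .ofNat b, .ofNat c => exact K.d_comp_d a b c
    | .ofNat _, .ofNat _, .negSucc _ => exact comp_zero
    | .ofNat _, .negSucc _, _ => exact zero_comp
    | .negSucc _, _, _ => exact zero_comp

/-- The extension by zero of a chain map. -/
def extendZMap {K L : ChainComplex C ℕ} (φ : K ⟶ L) : extendZ K ⟶ extendZ L where
  f
    | .ofNat n => φ.f n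
    | .negSucc _ => 0
  comm' i j _ := by
    match i, j with
    | .ofNat a, .ofNat b => exact φ.comm a b
    | .ofNat _, .negSucc _ => exact comp_zero.trans comp_zero.symm
    | .negSucc _, _ => exact zero_comp.trans zero_comp.symm

lemma isZero_extendZ (K : ChainComplex C ℕ) (i : ℤ) (h : i < 0) : IsZero ((extendZ K).X i) := by
  match i with
  | .ofNat n => exact absurd h (by simp)
  | .negSucc n => exact isZero_zero C

lemma extendZ_d_zero (K : ChainComplex C ℕ) (i j : ℤ) (h : j < 0) : (extendZ K).d i j = 0 :=
  (isZero_extendZ K j h).eq_of_tgt _ _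

instance extendZ_projective (K : ChainComplex C ℕ) [∀ n, Projective (K.X n)] (i : ℤ) :
    Projective ((extendZ K).X i) := by
  match i with
  | .ofNat n => exact inferInstanceAs (Projective (K.X n))
  | .negSucc _ => exact inferInstanceAs (Projective (0 : C))

/-- Degree `n` cocycles of the complex `Hom(K, M)`. -/
def cocycles (K : ChainComplex C ℤ) (M : C) (n : ℤ) : AddSubgroup (K.X n ⟶ M) where
  carrier := {u | ∀ j, K.d j n ≫ u = 0}
  zero_mem' _ := comp_zero
  add_mem' ha hb j := by rw [Preadditive.comp_add, ha j, hb j, add_zero]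
  neg_mem' ha j := by rw [Preadditive.comp_neg, ha j, neg_zero]

/-- Degree `n` coboundaries of the complex `Hom(K, M)`, inside the cocycles. -/
def coboundaries (K : ChainComplex C ℤ) (M : C) (n : ℤ) : AddSubgroup (cocycles K M n) where
  carrier := {u | ∃ w : K.X (n - 1) ⟶ M, u.1 = K.d n (n - 1) ≫ w}
  zero_mem' := ⟨0, comp_zero.symm⟩
  add_mem' := by
    rintro a b ⟨w, hw⟩ ⟨w', hw'⟩
    exact ⟨w + w', by simp [hw, hw']⟩
  neg_mem' := by
    rintro a ⟨w, hw⟩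
    exact ⟨-w, by simp [hw]⟩

/-- The cohomology group `Hⁿ(Hom(K, M))`; this is `Extⁿ(A, M)` when `K` is the extension by zero of
a projective resolution of `A`. It vanishes for `n < 0`. -/
abbrev ExtGroup (K : ChainComplex C ℤ) (M : C) (n : ℤ) : Type v :=
  cocycles K M n ⧸ coboundaries K M n

/-- The class of a cocycle. -/
def ExtGroup.mk {K : ChainComplex C ℤ} {M : C} {n : ℤ} (u : cocycles K M n) : ExtGroup K M n :=
  QuotientAddGroup.mk u

/-- Functoriality of `Ext` in both variables. -/
def ExtGroup.map {K L : ChainComplex C ℤ} {M N : C} (φ : L ⟶ K) (f : M ⟶ N) (n : ℤ) :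
    ExtGroup K M n →+ ExtGroup L N n :=
  QuotientAddGroup.map _ _
    (AddMonoidHom.mk' (fun u : cocycles K M n =>
        (⟨φ.f n ≫ u.1 ≫ f, fun j => by
          rw [← φ.comm_assoc, reassoc_of% (u.2 j), zero_comp, comp_zero]⟩ : cocycles L N n))
      (fun a b => by ext1; simp))
    (by
      rintro u ⟨w, hw⟩
      exact ⟨φ.f (n - 1) ≫ w ≫ f, by simp [hw]⟩)

lemma ExtGroup.map_mk {K L : ChainComplex C ℤ} {M N : C} (φ : L ⟶ K) (f : M ⟶ N) (n : ℤ)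
    (u : cocycles K M n) (v : cocycles L N n) (h : v.1 = φ.f n ≫ u.1 ≫ f) :
    ExtGroup.map φ f n (ExtGroup.mk u) = ExtGroup.mk v := by
  obtain ⟨v, hv⟩ := v
  obtain rfl : v = _ := h
  rfl

section Connecting

variable {K : ChainComplex C ℤ} {S : ShortComplex C} (hS : S.ShortExact) {n n' : ℤ}

lemma delta_isCocycle (hS : S.ShortExact) (s : ℤˣ) (u' : K.X n ⟶ S.X₂) (u'' : K.X n' ⟶ S.X₁)
    (h : u'' ≫ S.f = K.d n' n ≫ u') : s • u'' ∈ cocycles K S.X₁ n' := by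
  intro j
  have := hS.mono_f
  rw [← cancel_mono S.f, Linear.comp_units_smul, Linear.units_smul_comp, Category.assoc, h]
  simp

/-- The connecting homomorphism on a cocycle `u : Kₙ ⟶ X₃`: lift `u` to `Kₙ ⟶ X₂` by projectivity,
apply the differential `φ ↦ (-1)ⁿ⁺¹ φ ∘ d` of the complex `Hom(K, X₂)`, and factor the result through `X₁`. -/
def deltaFun [∀ i, Projective (K.X i)] (n' : ℤ) (u : cocycles K S.X₃ n) : ExtGroup K S.X₁ n' :=
  have := hS.epi_g
  have := hS.mono_f
  ExtGroup.mk ⟨(n + 1).negOnePow • hS.exact.lift (K.d n' n ≫ Projective.factorThru u.1 S.g)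
    (by rw [Category.assoc, Projective.factorThru_comp, u.2]), 
    delta_isCocycle hS _ _ _ (hS.exact.lift_f _ _)⟩


lemma deltaFun_eq [∀ i, Projective (K.X i)] (u : cocycles K S.X₃ n) (u' : K.X n ⟶ S.X₂)
    (u'' : K.X n' ⟶ S.X₁) (h' : u' ≫ S.g = u.1) (h : u'' ≫ S.f = K.d n' n ≫ u') (hn : n + 1 = n') :
    deltaFun hS n' u =
      ExtGroup.mk ⟨(n + 1).negOnePow • u'', delta_isCocycle hS _ _ _ h⟩ := by
  have := hS.epi_g
  have := hS.mono_f
  refine (QuotientAddGroup.eq).2 ?_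
  obtain rfl : n = n' - 1 := by omega
  refine ⟨(n' - 1 + 1).negOnePow • hS.exact.lift (u' - Projective.factorThru u.1 S.g)
    (by simp [h']), ?_⟩
  rw [← cancel_mono S.f]
  simp [Linear.units_smul_comp, Linear.comp_units_smul, h, smul_sub, neg_add_eq_sub]

/-- The connecting homomorphism `Extⁿ(-, X₃) → Extⁿ⁺¹(-, X₁)` of a short exact sequence
`0 → X₁ → X₂ → X₃ → 0`, for a complex of projectives. -/
def delta [∀ i, Projective (K.X i)] (hn : n + 1 = n') :
    ExtGroup K S.X₃ n →+ ExtGroup K S.X₁ n' :=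
  QuotientAddGroup.lift _
    (AddMonoidHom.mk' (deltaFun hS n') (fun a b => by
      have := hS.epi_g
      have := hS.mono_f
      rw [deltaFun_eq hS (a + b)
        (Projective.factorThru a.1 S.g + Projective.factorThru b.1 S.g)
        (hS.exact.lift (K.d n' n ≫ Projective.factorThru a.1 S.g) (by simp [a.2 n']) +
          hS.exact.lift (K.d n' n ≫ Projective.factorThru b.1 S.g) (by simp [b.2 n']))
        (by simp) (by simp) hn]
      refine congrArg QuotientAddGroup.mk (Subtype.ext ?_)
      exact smul_add _ _ _))
    (by
      rintro u ⟨w, hw⟩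
      have := hS.epi_g
      refine (deltaFun_eq hS u (K.d n (n - 1) ≫ Projective.factorThru w S.g) 0 (by simp [hw])
        (by simp) hn).trans ?_
      refine (QuotientAddGroup.eq_zero_iff _).2 ⟨0, by simp⟩)

lemma delta_mk [∀ i, Projective (K.X i)] (hn : n + 1 = n') (u : cocycles K S.X₃ n)
    (u' : K.X n ⟶ S.X₂) (u'' : K.X n' ⟶ S.X₁) (v : cocycles K S.X₁ n')
    (h' : u' ≫ S.g = u.1) (h : u'' ≫ S.f = K.d n' n ≫ u') (hv : v.1 = (n + 1).negOnePow • u'') :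
    delta hS hn (ExtGroup.mk u) = ExtGroup.mk v := by
  refine (deltaFun_eq hS u u' u'' h' h hn).trans ?_
  obtain ⟨v, hv'⟩ := v
  obtain rfl : v = _ := hv
  rfl

end Connecting

lemma ExtGroup.mk_surjective {K : ChainComplex C ℤ} {M : C} {n : ℤ} :
    Function.Surjective (ExtGroup.mk (K := K) (M := M) (n := n)) :=
  QuotientAddGroup.mk_surjective

lemma ExtGroup.mk_eq_zero {K : ChainComplex C ℤ} {M : C} {n : ℤ} (u : cocycles K M n)
    (h : ∃ w : K.X (n - 1) ⟶ M, u.1 = K.d n (n - 1) ≫ w) : ExtGroup.mk u = 0 :=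
  (QuotientAddGroup.eq_zero_iff u).2 h

lemma ExtGroup.mk_congr {K : ChainComplex C ℤ} {M : C} {n : ℤ} {u v : cocycles K M n}
    (h : u.1 = v.1) : ExtGroup.mk u = ExtGroup.mk v :=
  congrArg ExtGroup.mk (Subtype.ext h)

lemma ExtGroup.mk_add {K : ChainComplex C ℤ} {M : C} {n : ℤ} (u v : cocycles K M n) :
    ExtGroup.mk (u + v) = ExtGroup.mk u + ExtGroup.mk v := rfl

lemma ExtGroup.mk_units_smul {K : ChainComplex C ℤ} {M : C} {n : ℤ} (s : ℤˣ)
    (u v : cocycles K M n) (h : v.1 = s • u.1) : ExtGroup.mk v = s • ExtGroup.mk u := by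
  rcases Int.units_eq_one_or s with rfl | rfl
  · rw [one_smul]
    exact ExtGroup.mk_congr (by rw [h, one_smul])
  · rw [Units.neg_smul, one_smul]
    exact ExtGroup.mk_congr (v := -u) (by rw [h, Units.neg_smul, one_smul]; rfl)

/-- The connecting homomorphisms are natural. -/
lemma delta_naturality {K L : ChainComplex C ℤ} [∀ i, Projective (K.X i)]
    [∀ i, Projective (L.X i)] (φ : L ⟶ K) {S T : ShortComplex C} (hS : S.ShortExact)
    (hT : T.ShortExact) (α : S ⟶ T) {n n' : ℤ} (hn : n + 1 = n') (x : ExtGroup K S.X₃ n) :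
    ExtGroup.map φ α.τ₁ n' (delta hS hn x) = delta hT hn (ExtGroup.map φ α.τ₃ n x) := by
  have := hS.epi_g
  have := hS.mono_f
  obtain ⟨u, rfl⟩ := ExtGroup.mk_surjective x
  have e : K.d n' n ≫ Projective.factorThru u.1 S.g ≫ S.g = 0 := by simp [u.2 n']
  have e' := hS.exact.lift_f (K.d n' n ≫ Projective.factorThru u.1 S.g) (by simpa using e)
  have m : ∀ j, L.d j n ≫ φ.f n ≫ u.1 ≫ α.τ₃ = 0 := fun j => by
    rw [← φ.comm_assoc, reassoc_of% (u.2 j), zero_comp, comp_zero]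
  rw [delta_mk hS hn u _ _ ⟨_, delta_isCocycle hS _ _ _ e'⟩ (Projective.factorThru_comp _ _) e' rfl,
    ExtGroup.map_mk φ α.τ₃ n u ⟨_, m⟩ rfl]
  refine (ExtGroup.map_mk φ α.τ₁ n' _ ⟨_, ?_⟩ rfl).trans
    (delta_mk hT hn _ (φ.f n ≫ Projective.factorThru u.1 S.g ≫ α.τ₂)
      (φ.f n' ≫ hS.exact.lift (K.d n' n ≫ Projective.factorThru u.1 S.g) (by simpa using e) ≫ α.τ₁)
      _ ?_ ?_ ?_).symm
  · intro j
    rw [← φ.comm_assoc, ← Category.assoc (K.d j n'), 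
      show K.d j n' ≫ _ = 0 from delta_isCocycle hS _ _ _ e' j, zero_comp, comp_zero]
  · simp [α.comm₂₃]
  · simp [α.comm₁₂, reassoc_of% e']
  · simp [Linear.units_smul_comp, Linear.comp_units_smul]

end Ext

section Limits

/-- The transition maps of a sequence of abelian groups `G₀ → G₁ → G₂ → ⋯`. -/
def seqMap (G : ℕ → Type v) [∀ k, AddCommGroup (G k)] (f : ∀ k, G k →+ G (k + 1))
    (i j : ℕ) (h : i ≤ j) : G i →+ G j :=
  Nat.leRecOn h (fun {k} (g : G i →+ G k) => (f k).comp g) (AddMonoidHom.id (G i))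

variable {G H : ℕ → Type v} [∀ k, AddCommGroup (G k)] [∀ k, AddCommGroup (H k)]
  (f : ∀ k, G k →+ G (k + 1)) (g : ∀ k, H k →+ H (k + 1))

lemma seqMap_self (i : ℕ) (x : G i) : seqMap G f i i le_rfl x = x := by
  rw [seqMap, Nat.leRecOn_self]; rfl

lemma seqMap_succ (i j : ℕ) (h : i ≤ j) (h' : i ≤ j + 1) (x : G i) :
    seqMap G f i (j + 1) h' x = f j (seqMap G f i j h x) := by
  rw [seqMap, Nat.leRecOn_succ h]; rfl

lemma seqMap_succ_left (i j : ℕ) (h : i + 1 ≤ j) (h' : i ≤ j) (x : G i) :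
    seqMap G f (i + 1) j h (f i x) = seqMap G f i j h' x := by
  induction j, h using Nat.le_induction with
  | base => rw [seqMap_self, seqMap_succ f i i le_rfl, seqMap_self]
  | succ j hj ih => rw [seqMap_succ f _ j hj, seqMap_succ f _ j (by omega), ih]

/-- The direct limit of a sequence of abelian groups `G₀ → G₁ → G₂ → ⋯`. -/
abbrev SeqColim (f : ∀ k, G k →+ G (k + 1)) : Type v :=
  AddCommGroup.DirectLimit G (seqMap G f)

/-- The canonical map from a term of a sequence to its direct limit. -/
abbrev SeqColim.of (k : ℕ) : G k →+ SeqColim f :=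
  AddCommGroup.DirectLimit.of G (seqMap G f) k

lemma SeqColim.of_succ (k : ℕ) (x : G k) : SeqColim.of f (k + 1) (f k x) = SeqColim.of f k x := by
  rw [← AddCommGroup.DirectLimit.of_f (f := seqMap G f) (Nat.le_succ k) x,
    seqMap_succ f k k le_rfl, seqMap_self]

/-- Maps out of the direct limit of a sequence. -/
def SeqColim.desc {P : Type*} [AddCommGroup P] (a : ∀ k, G k →+ P)
    (ha : ∀ k x, a (k + 1) (f k x) = a k x) : SeqColim f →+ P :=
  AddCommGroup.DirectLimit.lift G (seqMap G f) P a (fun i j hij x => by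
    induction j, hij using Nat.le_induction with
    | base => rw [seqMap_self]
    | succ j hj ih => rw [seqMap_succ f i j hj, ha, ih])

@[simp]
lemma SeqColim.desc_of {P : Type*} [AddCommGroup P] (a : ∀ k, G k →+ P)
    (ha : ∀ k x, a (k + 1) (f k x) = a k x) (k : ℕ) (x : G k) :
    SeqColim.desc f a ha (SeqColim.of f k x) = a k x :=
  AddCommGroup.DirectLimit.lift_of _ _ _ _ _

/-- The map of direct limits induced by a map of sequences. -/
def SeqColim.map (a : ∀ k, G k →+ H k) (ha : ∀ k x, a (k + 1) (f k x) = g k (a k x)) :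
    SeqColim f →+ SeqColim g :=
  SeqColim.desc f (fun k => (SeqColim.of g k).comp (a k)) (fun k x => by
    simp only [AddMonoidHom.comp_apply]
    rw [ha, SeqColim.of_succ])

lemma SeqColim.hom_ext {P : Type*} [AddCommGroup P] {a b : SeqColim f →+ P}
    (h : ∀ k x, a (SeqColim.of f k x) = b (SeqColim.of f k x)) : a = b :=
  AddCommGroup.DirectLimit.hom_ext _ (fun k => AddMonoidHom.ext (h k))

/-- A position `(p, q)` on the staircase path in `ℕ × ℕ`, together with the direction of the next
step: `true` increases `p`, `false` increases `q`. -/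
structure Stage where
  p : ℕ
  q : ℕ
  dir : Bool

/-- One step along the staircase path; the directions alternate. -/
def Stage.next : Stage → Stage
  | ⟨p, q, true⟩ => ⟨p + 1, q, false⟩
  | ⟨p, q, false⟩ => ⟨p, q + 1, true⟩

/-- The staircase path `(0,0), (1,0), (1,1), (2,1), (2,2), …`. -/
def path : ℕ → Stage
  | 0 => ⟨0, 0, true⟩
  | j + 1 => (path j).next

lemma path_sum (j : ℕ) : (path j).p + (path j).q = j := by
  induction j with
  | zero => rfl
  | succ j ih =>
    rw [path]
    revert ih
    rcases path j with ⟨p, q, b⟩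
    cases b <;> simp only [Stage.next] <;> omega

lemma path_two_mul (k : ℕ) : path (2 * k) = ⟨k, k, true⟩ := by
  induction k with
  | zero => rfl
  | succ k ih =>
    change ((path (2 * k)).next).next = _
    rw [ih]; rfl

/-- The tensor product of two homomorphisms of abelian groups. -/
def tensorMap {M M' N N' : Type*} [AddCommGroup M] [AddCommGroup M'] [AddCommGroup N]
    [AddCommGroup N'] (a : M →+ M') (b : N →+ N') : M ⊗[ℤ] N →+ M' ⊗[ℤ] N' :=
  (TensorProduct.map a.toIntLinearMap b.toIntLinearMap).toAddMonoidHom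

@[simp]
lemma tensorMap_tmul {M M' N N' : Type*} [AddCommGroup M] [AddCommGroup M'] [AddCommGroup N]
    [AddCommGroup N'] (a : M →+ M') (b : N →+ N') (x : M) (y : N) :
    tensorMap a b (x ⊗ₜ y) = a x ⊗ₜ b y := rfl

lemma tensor_hom_ext {M N P : Type*} [AddCommGroup M] [AddCommGroup N] [AddCommGroup P]
    {a b : M ⊗[ℤ] N →+ P} (h : ∀ x y, a (x ⊗ₜ y) = b (x ⊗ₜ y)) : a = b := by
  ext z
  induction z using TensorProduct.induction_on with
  | zero => simp
  | add u v hu hv => rw [map_add, map_add, hu, hv]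
  | tmul x y => exact h x y

/-- The transition map of the staircase system `G p ⊗ H q`: it is `f ⊗ id` if `p` increases and
`id ⊗ g` if `q` increases, multiplied with a sign. -/
def stepMap (ε : Stage → ℤˣ) : ∀ s : Stage,
    G s.p ⊗[ℤ] H s.q →+ G s.next.p ⊗[ℤ] H s.next.q
  | ⟨p, q, true⟩ => ε ⟨p, q, true⟩ • tensorMap (f p) (AddMonoidHom.id (H q))
  | ⟨p, q, false⟩ => ε ⟨p, q, false⟩ • tensorMap (AddMonoidHom.id (G p)) (g q)

/-- The transition maps of the staircase system along the staircase path. -/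
def stairStep (ε : Stage → ℤˣ) (j : ℕ) :
    G (path j).p ⊗[ℤ] H (path j).q →+ G (path (j + 1)).p ⊗[ℤ] H (path (j + 1)).q :=
  stepMap f g ε (path j)

/-- The accumulated sign along the staircase path. -/
def totalSign (ε : Stage → ℤˣ) (j : ℕ) : ℤˣ := ∏ i ∈ Finset.range j, ε (path i)

/-- The direct limit of the staircase system
`G₀ ⊗ H₀ → G₁ ⊗ H₀ → G₁ ⊗ H₁ → G₂ ⊗ H₁ → ⋯` with signs `ε`. -/
abbrev StairColim (ε : Stage → ℤˣ) : Type v :=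
  SeqColim (G := fun j => G (path j).p ⊗[ℤ] H (path j).q) (stairStep f g ε)

lemma comp_stepMap {P : Type*} [AddCommGroup P] (ε η : Stage → ℤˣ)
    (a : ∀ p q, G p ⊗[ℤ] H q →+ P)
    (h₁ : ∀ p q x y, a (p + 1) q (f p x ⊗ₜ y) = η ⟨p, q, true⟩ • a p q (x ⊗ₜ y))
    (h₂ : ∀ p q x y, a p (q + 1) (x ⊗ₜ g q y) = η ⟨p, q, false⟩ • a p q (x ⊗ₜ y))
    (s : Stage) (z : G s.p ⊗[ℤ] H s.q) :
    a s.next.p s.next.q (stepMap f g ε s z) = (ε s * η s) • a s.p s.q z := by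
  rcases s with ⟨p, q, b⟩
  cases b
  · refine DFunLike.congr_fun (f := (a p (q + 1)).comp
      (ε ⟨p, q, false⟩ • tensorMap (AddMonoidHom.id (G p)) (g q)))
      (g := (ε ⟨p, q, false⟩ * η ⟨p, q, false⟩) • a p q)
      (tensor_hom_ext fun x y => ?_) z
    simp only [AddMonoidHom.comp_apply, AddMonoidHom.smul_apply, tensorMap_tmul,
      AddMonoidHom.id_apply]
    rw [Units.smul_def, map_zsmul, ← Units.smul_def, h₂, smul_smul]
  · refine DFunLike.congr_fun (f := (a (p + 1) q).comp
      (ε ⟨p, q, true⟩ • tensorMap (f p) (AddMonoidHom.id (H q))))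
      (g := (ε ⟨p, q, true⟩ * η ⟨p, q, true⟩) • a p q)
      (tensor_hom_ext fun x y => ?_) z
    simp only [AddMonoidHom.comp_apply, AddMonoidHom.smul_apply, tensorMap_tmul,
      AddMonoidHom.id_apply]
    rw [Units.smul_def, map_zsmul, ← Units.smul_def, h₁, smul_smul]

lemma comp_stairStep {P : Type*} [AddCommGroup P] (ε η : Stage → ℤˣ)
    (a : ∀ p q, G p ⊗[ℤ] H q →+ P)
    (h₁ : ∀ p q x y, a (p + 1) q (f p x ⊗ₜ y) = η ⟨p, q, true⟩ • a p q (x ⊗ₜ y))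
    (h₂ : ∀ p q x y, a p (q + 1) (x ⊗ₜ g q y) = η ⟨p, q, false⟩ • a p q (x ⊗ₜ y))
    (j : ℕ) (z : G (path j).p ⊗[ℤ] H (path j).q) :
    a (path (j + 1)).p (path (j + 1)).q (stairStep f g ε j z) =
      (ε (path j) * η (path j)) • a (path j).p (path j).q z :=
  comp_stepMap f g ε η a h₁ h₂ (path j) z

/-- The comparison map from the direct limit of the staircase system to the tensor product of the
direct limits. On the `j`-th term it is the tensor product of the canonical maps, multiplied with
the accumulated sign, so that the signs of the transition maps cancel. -/
def stairToTensor (ε : Stage → ℤˣ) : StairColim f g ε →+ SeqColim f ⊗[ℤ] SeqColim g :=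
  SeqColim.desc _
    (fun j => totalSign ε j • tensorMap (SeqColim.of f (path j).p) (SeqColim.of g (path j).q))
    (fun j z => by
      have h := comp_stairStep f g ε (fun _ => 1)
        (fun p q => tensorMap (SeqColim.of f p) (SeqColim.of g q))
        (fun p q x y => by simp [SeqColim.of_succ]) (fun p q x y => by simp [SeqColim.of_succ])
        j z
      rw [AddMonoidHom.smul_apply, h, totalSign, Finset.prod_range_succ, smul_smul, mul_one, mul_assoc, Int.units_mul_self,
        mul_one]
      rfl)

lemma stairToTensor_of (ε : Stage → ℤˣ) (j : ℕ) (z : G (path j).p ⊗[ℤ] H (path j).q) :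
    stairToTensor f g ε (SeqColim.of (stairStep f g ε) j z) =
      totalSign ε j • tensorMap (SeqColim.of f (path j).p) (SeqColim.of g (path j).q) z :=
  SeqColim.desc_of _ _ _ _ _

/-- Auxiliary bilinear map for the inverse of `stairToTensor`. -/
def stairPair (ε : Stage → ℤˣ) (j a b : ℕ) (ha : a ≤ (path j).p) (hb : b ≤ (path j).q) :
    G a →+ H b →+ StairColim f g ε :=
  AddMonoidHom.mk' (fun x => AddMonoidHom.mk' (fun y =>
    totalSign ε j • SeqColim.of (stairStep f g ε) j
      (seqMap G f a _ ha x ⊗ₜ seqMap H g b _ hb y))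
    (fun y y' => by rw [map_add, TensorProduct.tmul_add, map_add, smul_add]))
    (fun x x' => by
      ext y
      simp only [AddMonoidHom.mk'_apply, AddMonoidHom.add_apply]
      rw [map_add, TensorProduct.add_tmul, map_add, smul_add])

lemma stepMap_tmul_seqMap (ε : Stage → ℤˣ) (s : Stage) (a b : ℕ) (ha : a ≤ s.p) (hb : b ≤ s.q)
    (ha' : a ≤ s.next.p) (hb' : b ≤ s.next.q) (x : G a) (y : H b) :
    stepMap f g ε s (seqMap G f a _ ha x ⊗ₜ seqMap H g b _ hb y) =
      ε s • (seqMap G f a _ ha' x ⊗ₜ seqMap H g b _ hb' y) := by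
  rcases s with ⟨p, q, _ | _⟩
  · exact congrArg (fun t => ε ⟨p, q, false⟩ • (seqMap G f a p ha x ⊗ₜ[ℤ] t))
      (seqMap_succ g b q hb hb' y).symm
  · exact congrArg (fun t => ε ⟨p, q, true⟩ • (t ⊗ₜ[ℤ] seqMap H g b q hb y))
      (seqMap_succ f a p ha ha' x).symm

lemma path_mono_succ (j : ℕ) : (path j).p ≤ (path (j + 1)).p ∧ (path j).q ≤ (path (j + 1)).q := by
  rw [path]
  rcases path j with ⟨p, q, _ | _⟩ <;> simp [Stage.next]

lemma path_mono {j j' : ℕ} (h : j ≤ j') :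
    (path j).p ≤ (path j').p ∧ (path j).q ≤ (path j').q := by
  induction j', h using Nat.le_induction with
  | base => simp
  | succ k _ ih => exact ⟨ih.1.trans (path_mono_succ k).1, ih.2.trans (path_mono_succ k).2⟩

lemma stairPair_succ (ε : Stage → ℤˣ) (j a b : ℕ) (ha : a ≤ (path j).p) (hb : b ≤ (path j).q)
    (ha' : a ≤ (path (j + 1)).p) (hb' : b ≤ (path (j + 1)).q) :
    stairPair f g ε (j + 1) a b ha' hb' = stairPair f g ε j a b ha hb := by
  ext x y
  simp only [stairPair, AddMonoidHom.mk'_apply]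
  have h : stairStep f g ε j _ = ε (path j) •
      (seqMap G f a (path (j + 1)).p ha' x ⊗ₜ[ℤ] seqMap H g b (path (j + 1)).q hb' y) := stepMap_tmul_seqMap f g ε (path j) a b ha hb ha' hb' x y
  rw [← SeqColim.of_succ (stairStep f g ε) j, h, totalSign, Finset.prod_range_succ, Units.smul_def (ε (path j)), map_zsmul,
    ← Units.smul_def, smul_smul]
  rfl

lemma stairPair_le (ε : Stage → ℤˣ) {j j' : ℕ} (h : j ≤ j') (a b : ℕ) (ha : a ≤ (path j).p)
    (hb : b ≤ (path j).q) (ha' : a ≤ (path j').p) (hb' : b ≤ (path j').q) :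
    stairPair f g ε j' a b ha' hb' = stairPair f g ε j a b ha hb := by
  induction j', h using Nat.le_induction with
  | base => rfl
  | succ k hk ih =>
    rw [stairPair_succ f g ε k a b (ha.trans (path_mono hk).1) (hb.trans (path_mono hk).2), ih]

lemma stairPair_eq (ε : Stage → ℤˣ) {j j' : ℕ} (a b : ℕ) (ha : a ≤ (path j).p)
    (hb : b ≤ (path j).q) (ha' : a ≤ (path j').p) (hb' : b ≤ (path j').q) :
    stairPair f g ε j' a b ha' hb' = stairPair f g ε j a b ha hb := by
  rcases le_total j j' with h | h
  · exact stairPair_le f g ε h a b ha hb ha' hb'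
  · exact (stairPair_le f g ε h a b ha' hb' ha hb).symm

lemma le_path_p (a b : ℕ) : a ≤ (path (2 * max a b)).p := by
  rw [path_two_mul]; exact le_max_left _ _

lemma le_path_q (a b : ℕ) : b ≤ (path (2 * max a b)).q := by
  rw [path_two_mul]; exact le_max_right _ _

/-- Auxiliary bilinear map for the inverse of `stairToTensor`. -/
def stairPair' (ε : Stage → ℤˣ) (a b : ℕ) : G a →+ H b →+ StairColim f g ε :=
  stairPair f g ε (2 * max a b) a b (le_path_p a b) (le_path_q a b)

lemma stairPair'_left (ε : Stage → ℤˣ) (a b : ℕ) (x : G a) (y : H b) :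
    stairPair' f g ε (a + 1) b (f a x) y = stairPair' f g ε a b x y := by
  have h := le_path_p (a + 1) b
  rw [stairPair', stairPair', stairPair_eq f g ε a b (j := 2 * max (a + 1) b)
    (by omega) (le_path_q (a + 1) b)]
  simp only [stairPair, AddMonoidHom.mk'_apply]
  rw [seqMap_succ_left]

lemma stairPair'_right (ε : Stage → ℤˣ) (a b : ℕ) (x : G a) (y : H b) :
    stairPair' f g ε a (b + 1) x (g b y) = stairPair' f g ε a b x y := by
  have h := le_path_q a (b + 1)
  rw [stairPair', stairPair', stairPair_eq f g ε a b (j := 2 * max a (b + 1))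
    (le_path_p a (b + 1)) (by omega)]
  simp only [stairPair, AddMonoidHom.mk'_apply]
  rw [seqMap_succ_left]

/-- The inverse of `stairToTensor`. -/
def tensorToStair (ε : Stage → ℤˣ) : SeqColim f ⊗[ℤ] SeqColim g →+ StairColim f g ε :=
  TensorProduct.liftAddHom
    (SeqColim.desc f (fun a => AddMonoidHom.mk' (fun x =>
        SeqColim.desc g (fun b => stairPair' f g ε a b x)
          (fun b y => stairPair'_right f g ε a b x y))
        (fun x x' => SeqColim.hom_ext g fun b y => by
          simp only [AddMonoidHom.add_apply, SeqColim.desc_of]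
          rw [map_add, AddMonoidHom.add_apply]))
      (fun a x => SeqColim.hom_ext g fun b y => by
        simp only [AddMonoidHom.mk'_apply, SeqColim.desc_of]
        exact stairPair'_left f g ε a b x y))
    (fun r m n => by rw [map_zsmul, AddMonoidHom.smul_apply, map_zsmul])

lemma tensorToStair_of (ε : Stage → ℤˣ) (a b : ℕ) (x : G a) (y : H b) :
    tensorToStair f g ε (SeqColim.of f a x ⊗ₜ SeqColim.of g b y) = stairPair' f g ε a b x y := by
  refine (TensorProduct.liftAddHom_tmul _ _ _ _).trans ?_
  simp

lemma of_seqMap (i j : ℕ) (h : i ≤ j) (x : G i) :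
    SeqColim.of f j (seqMap G f i j h x) = SeqColim.of f i x :=
  AddCommGroup.DirectLimit.of_f h x

/-- The direct limit of the staircase system is the tensor product of the direct limits. -/
def stairEquiv (ε : Stage → ℤˣ) : StairColim f g ε ≃+ SeqColim f ⊗[ℤ] SeqColim g :=
  AddMonoidHom.toAddEquiv (stairToTensor f g ε) (tensorToStair f g ε)
    (SeqColim.hom_ext _ fun j z => by
      refine DFunLike.congr_fun (f := ((tensorToStair f g ε).comp (stairToTensor f g ε)).comp
        (SeqColim.of (stairStep f g ε) j)) (g := SeqColim.of (stairStep f g ε) j)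
        (tensor_hom_ext fun x y => ?_) z
      rw [AddMonoidHom.comp_apply, AddMonoidHom.comp_apply, stairToTensor_of, tensorMap_tmul,
        Units.smul_def, map_zsmul, tensorToStair_of, stairPair',
        stairPair_eq f g ε _ _ (j := j) le_rfl le_rfl]
      simp only [stairPair, AddMonoidHom.mk'_apply]
      rw [seqMap_self, seqMap_self, ← Units.smul_def, smul_smul, Int.units_mul_self, one_smul])
    (tensor_hom_ext fun x y => by
      induction x using AddCommGroup.DirectLimit.induction_on with | ih a x => ?_
      induction y using AddCommGroup.DirectLimit.induction_on with | ih b y => ?_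
      rw [AddMonoidHom.comp_apply, tensorToStair_of]
      simp only [stairPair', stairPair, AddMonoidHom.mk'_apply]
      rw [Units.smul_def, map_zsmul, stairToTensor_of,
        tensorMap_tmul, of_seqMap, of_seqMap, ← Units.smul_def, smul_smul, Int.units_mul_self,
        one_smul]
      rfl)

end Limits
section Completed

variable {C : Type u} [Category.{v} C] [Abelian C]

variable (C) in
/-- A projective resolution, spliced from short exact sequences
`0 → Ω (k + 1) → P k → Ω k → 0` with `P k` projective. It is a projective resolution
`⋯ → P 1 → P 0 → Ω 0 → 0` of the object `Ω 0` together with a choice of its syzygies `Ω k`. -/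
structure SplicedResolution where
  Ω : ℕ → C
  P : ℕ → C
  ι : ∀ k, Ω (k + 1) ⟶ P k
  π : ∀ k, P k ⟶ Ω k
  w : ∀ k, ι k ≫ π k = 0
  shortExact : ∀ k, (ShortComplex.mk (ι k) (π k) (w k)).ShortExact
  projective : ∀ k, Projective (P k)

namespace SplicedResolution

/-- The `k`-th short exact sequence `0 → Ω (k + 1) → P k → Ω k → 0`. -/
abbrev seq (Q : SplicedResolution C) (k : ℕ) : ShortComplex C :=
  ShortComplex.mk (Q.ι k) (Q.π k) (Q.w k)

/-- A morphism out of `Ω k` lifts to the `k`-th short exact sequence. -/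
lemma exists_lift (Q Q' : SplicedResolution C) (k : ℕ) (a : Q.Ω k ⟶ Q'.Ω k) :
    ∃ α : Q.seq k ⟶ Q'.seq k, α.τ₃ = a := by
  have := Q.projective k
  have := (Q'.shortExact k).epi_g
  have := (Q'.shortExact k).mono_f
  have h : Projective.factorThru (Q.π k ≫ a) (Q'.π k) ≫ Q'.π k = Q.π k ≫ a :=
    Projective.factorThru_comp _ _
  have h' := (Q'.shortExact k).exact.lift_f
    (Q.ι k ≫ Projective.factorThru (Q.π k ≫ a) (Q'.π k))
    (by dsimp; rw [Category.assoc, h, ← Category.assoc, Q.w, zero_comp])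
  exact ⟨{ τ₁ := _, τ₂ := _, τ₃ := a, comm₁₂ := h', comm₂₃ := h }, rfl⟩

/-- The morphisms on syzygies induced by a morphism `Ω 0 ⟶ Ω' 0` through a lift to the
resolutions. -/
def lift (Q Q' : SplicedResolution C) (a : Q.Ω 0 ⟶ Q'.Ω 0) : ∀ k, Q.Ω k ⟶ Q'.Ω k
  | 0 => a
  | k + 1 => (exists_lift Q Q' k (lift Q Q' a k)).choose.τ₁

/-- The chosen lift as a morphism of short exact sequences. -/
lemma exists_lift_seq (Q Q' : SplicedResolution C) (a : Q.Ω 0 ⟶ Q'.Ω 0) (k : ℕ) :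
    ∃ α : Q.seq k ⟶ Q'.seq k, α.τ₃ = lift Q Q' a k ∧ α.τ₁ = lift Q Q' a (k + 1) :=
  ⟨_, (exists_lift Q Q' k (lift Q Q' a k)).choose_spec, rfl⟩

end SplicedResolution

/-- The complex of projectives indexed over `ℤ` that is given by a projective resolution. -/
abbrev resolutionZ {A : C} (P : ProjectiveResolution A) : ChainComplex C ℤ := extendZ P.complex

/-- `Extⁿ(A, M)`, computed from a projective resolution of `A`. -/
abbrev ExtOf {A : C} (P : ProjectiveResolution A) (M : C) (n : ℤ) : Type v :=
  ExtGroup (resolutionZ P) M n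

/-- The connecting homomorphism `Extⁿ⁺ᵏ(A, Ωₖ) → Extⁿ⁺ᵏ⁺¹(A, Ωₖ₊₁)`. -/
def syzygyDelta {A : C} (P : ProjectiveResolution A) (Q : SplicedResolution C) (n : ℤ) (k : ℕ) :
    ExtOf P (Q.Ω k) (n + k) →+ ExtOf P (Q.Ω (k + 1)) (n + (k + 1 : ℕ)) :=
  delta (Q.shortExact k) (by push_cast; ring)

/-- The completed Ext-group `Êxtⁿ(A, B)` for a projective resolution `P` of `A` and a projective
resolution `Q` of `B`, as the direct limit of `Extⁿ⁺ᵏ(A, Ωₖ)` over the connecting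
homomorphisms. -/
abbrev ExtHat {A : C} (P : ProjectiveResolution A) (Q : SplicedResolution C) (n : ℤ) :
    Type v :=
  SeqColim (syzygyDelta P Q n)

/-- The canonical map `Extⁿ⁺ᵏ(A, Ωₖ) → Êxtⁿ(A, B)`. -/
abbrev ExtHat.of {A : C} (P : ProjectiveResolution A) (Q : SplicedResolution C) (n : ℤ)
    (k : ℕ) : ExtOf P (Q.Ω k) (n + k) →+ ExtHat P Q n :=
  SeqColim.of (syzygyDelta P Q n) k

/-- The homomorphism `Êxtⁿ(r, a) : Êxtⁿ(A, B) → Êxtⁿ(A', B')` induced by `r : A' ⟶ A` and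
`a : B ⟶ B'`: one lifts `r` to a chain map of resolutions and `a` to the syzygies. -/
def ExtHat.map {A A' : C} (P : ProjectiveResolution A) (P' : ProjectiveResolution A')
    (Q Q' : SplicedResolution C) (r : A' ⟶ A) (a : Q.Ω 0 ⟶ Q'.Ω 0) (n : ℤ) :
    ExtHat P Q n →+ ExtHat P' Q' n :=
  SeqColim.map _ _
    (fun k => ExtGroup.map (extendZMap (ProjectiveResolution.lift r P' P))
      (SplicedResolution.lift Q Q' a k) (n + k))
    (fun k x => by
      obtain ⟨α, h₃, h₁⟩ := SplicedResolution.exists_lift_seq Q Q' a k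
      rw [← h₃, ← h₁]
      exact delta_naturality _ (Q.shortExact k) (Q'.shortExact k) α _ x)

end Completed

section Tensor

variable {C : Type u} [Category.{v} C] [Abelian C] [MonoidalCategory C] [MonoidalPreadditive C]

/-- The projection of the tensor product of two complexes onto the summand `K i ⊗ L j`. -/
def tensorProj (K L : ChainComplex C ℕ) (i j d : ℕ) :
    (HomologicalComplex.tensorObj K L).X d ⟶ K.X i ⊗ L.X j :=
  HomologicalComplex.mapBifunctorDesc (F := curriedTensor C) (fun i' j' _ =>
    if h : i' = i ∧ j' = j then
      eqToHom (by obtain ⟨rfl, rfl⟩ := h; rfl : K.X i' ⊗ L.X j' = K.X i ⊗ L.X j)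
    else 0)

lemma ι_tensorProj_self (K L : ChainComplex C ℕ) (i j d : ℕ) (h : i + j = d) :
    HomologicalComplex.ιTensorObj K L i j d h ≫ tensorProj K L i j d = 𝟙 (K.X i ⊗ L.X j) := by
  refine (HomologicalComplex.ι_mapBifunctorDesc _ _ _ _).trans ?_
  rw [dif_pos ⟨rfl, rfl⟩]; rfl

lemma ι_tensorProj_of_ne (K L : ChainComplex C ℕ) (i j i' j' d : ℕ) (h : i' + j' = d)
    (hne : ¬ (i' = i ∧ j' = j)) :
    HomologicalComplex.ιTensorObj K L i' j' d h ≫ tensorProj K L i j d = 0 := by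
  refine (HomologicalComplex.ι_mapBifunctorDesc _ _ _ _).trans ?_
  rw [dif_neg hne]

lemma tensor_hom_ext' {K L : ChainComplex C ℕ} {d : ℕ} {Y : C}
    {a b : (HomologicalComplex.tensorObj K L).X d ⟶ Y}
    (h : ∀ i j (hij : i + j = d), HomologicalComplex.ιTensorObj K L i j d hij ≫ a =
      HomologicalComplex.ιTensorObj K L i j d hij ≫ b) : a = b :=
  HomologicalComplex.mapBifunctor.hom_ext h

lemma tensor_D₁_proj (K L : ChainComplex C ℕ) (i j d : ℕ) (h : i + j = d) :
    HomologicalComplex.mapBifunctor.D₁ K L (curriedTensor C) (ComplexShape.down ℕ) (d + 1) d ≫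
      tensorProj K L i j d = tensorProj K L (i + 1) j (d + 1) ≫ (K.d (i + 1) i ▷ L.X j) := by
  refine tensor_hom_ext' fun i' j' hij => ?_
  rw [HomologicalComplex.mapBifunctor.ι_D₁_assoc]
  cases i' with
  | zero =>
    rw [HomologicalComplex.mapBifunctor.d₁_eq_zero _ _ _ _ _ _ _ (by simp), zero_comp,
      ← Category.assoc, ι_tensorProj_of_ne _ _ _ _ _ _ _ _ (by simp), zero_comp]
  | succ a =>
    rw [HomologicalComplex.mapBifunctor.d₁_eq K L (curriedTensor C) _ (i₁' := a) rfl _ _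
      (show a + j' = d by omega)]
    have e : ComplexShape.ε₁ (ComplexShape.down ℕ) (ComplexShape.down ℕ) (ComplexShape.down ℕ)
      (a + 1, j') = 1 := rfl
    rw [e, one_smul, Category.assoc]
    by_cases h' : a = i ∧ j' = j
    · obtain ⟨rfl, rfl⟩ := h'
      have e₁ := ι_tensorProj_self K L a j' d h
      have e₂ := ι_tensorProj_self K L (a + 1) j' (d + 1) hij
      rw [reassoc_of% e₂]
      erw [e₁]
      exact Category.comp_id _
    · have e₁ := ι_tensorProj_of_ne K L i j a j' d (by omega) h'
      have e₂ := ι_tensorProj_of_ne K L (i + 1) j (a + 1) j' (d + 1) hij (by simpa using h')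
      rw [reassoc_of% e₂]
      erw [e₁]
      rw [comp_zero, zero_comp]

lemma tensor_D₂_proj (K L : ChainComplex C ℕ) (i j d : ℕ) (h : i + j = d) :
    HomologicalComplex.mapBifunctor.D₂ K L (curriedTensor C) (ComplexShape.down ℕ) (d + 1) d ≫
      tensorProj K L i j d =
      (-1 : ℤˣ) ^ i • (tensorProj K L i (j + 1) (d + 1) ≫ (K.X i ◁ L.d (j + 1) j)) := by
  refine tensor_hom_ext' fun i' j' hij => ?_
  rw [HomologicalComplex.mapBifunctor.ι_D₂_assoc, Linear.comp_units_smul]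
  cases j' with
  | zero =>
    rw [HomologicalComplex.mapBifunctor.d₂_eq_zero _ _ _ _ _ _ _ (by simp), zero_comp,
      ← Category.assoc, ι_tensorProj_of_ne _ _ _ _ _ _ _ _ (by simp), zero_comp, smul_zero]
  | succ a =>
    rw [HomologicalComplex.mapBifunctor.d₂_eq K L (curriedTensor C) _ _ (i₂' := a) rfl _
      (show i' + a = d by omega)]
    have e : ComplexShape.ε₂ (ComplexShape.down ℕ) (ComplexShape.down ℕ) (ComplexShape.down ℕ)
      (i', a + 1) = (-1 : ℤˣ) ^ i' := rfl
    rw [e, Linear.units_smul_comp, Category.assoc]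
    by_cases h' : i' = i ∧ a = j
    · obtain ⟨rfl, rfl⟩ := h'
      have e₁ := ι_tensorProj_self K L i' a d h
      have e₂ := ι_tensorProj_self K L i' (a + 1) (d + 1) hij
      rw [reassoc_of% e₂]
      erw [e₁]
      exact congrArg _ (Category.comp_id _)
    · have e₁ := ι_tensorProj_of_ne K L i j i' a d (by omega) h'
      have e₂ := ι_tensorProj_of_ne K L i (j + 1) i' (a + 1) (d + 1) hij (by simpa using h')
      rw [reassoc_of% e₂]
      erw [e₁]
      rw [comp_zero, zero_comp, smul_zero, smul_zero]

/-- The differential of the tensor product of two complexes is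
`d (x ⊗ y) = d x ⊗ y + (-1)ⁱ x ⊗ d y` for `x` of degree `i`. -/
lemma tensor_d_proj (K L : ChainComplex C ℕ) (i j d : ℕ) (h : i + j = d) :
    (HomologicalComplex.tensorObj K L).d (d + 1) d ≫ tensorProj K L i j d =
      tensorProj K L (i + 1) j (d + 1) ≫ (K.d (i + 1) i ▷ L.X j) +
      (-1 : ℤˣ) ^ i • (tensorProj K L i (j + 1) (d + 1) ≫ (K.X i ◁ L.d (j + 1) j)) := by
  rw [HomologicalComplex.mapBifunctor.d_eq, Preadditive.add_comp, tensor_D₁_proj _ _ _ _ _ h,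
    tensor_D₂_proj _ _ _ _ _ h]

/-- The projection onto a summand, after extension by zero to all integer degrees. -/
def projZ (K L : ChainComplex C ℕ) : ∀ i j d : ℤ,
    (extendZ (HomologicalComplex.tensorObj K L)).X d ⟶ (extendZ K).X i ⊗ (extendZ L).X j
  | .ofNat i, .ofNat j, .ofNat d => tensorProj K L i j d
  | .ofNat _, .ofNat _, .negSucc _ => 0
  | .ofNat _, .negSucc _, _ => 0
  | .negSucc _, _, _ => 0

lemma projZ_zero (K L : ChainComplex C ℕ) (i j d : ℤ) (h : i < 0 ∨ j < 0) :
    projZ K L i j d = 0 := by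
  match i, j, d with
  | .ofNat i, .ofNat j, .ofNat d => exact absurd h (by simp)
  | .ofNat _, .ofNat _, .negSucc _ => rfl
  | .ofNat _, .negSucc _, _ => rfl
  | .negSucc _, _, _ => rfl

lemma projZ_d (K L : ChainComplex C ℕ) (i j d d' : ℤ) (h : i + j = d) (h' : d + 1 = d') :
    (extendZ (HomologicalComplex.tensorObj K L)).d d' d ≫ projZ K L i j d =
      projZ K L (i + 1) j d' ≫ ((extendZ K).d (i + 1) i ▷ (extendZ L).X j) +
      i.negOnePow • (projZ K L i (j + 1) d' ≫ ((extendZ K).X i ◁ (extendZ L).d (j + 1) j)) := by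
  subst h'
  rcases lt_or_ge i 0 with hi | hi
  · rw [projZ_zero K L i j d (Or.inl hi), projZ_zero K L i (j + 1) _ (Or.inl hi),
      extendZ_d_zero K _ i hi]
    simp
  rcases lt_or_ge j 0 with hj | hj
  · rw [projZ_zero K L i j d (Or.inr hj), projZ_zero K L (i + 1) j _ (Or.inr hj),
      extendZ_d_zero L _ j hj]
    simp
  obtain ⟨i, rfl⟩ := Int.eq_ofNat_of_zero_le hi
  obtain ⟨j, rfl⟩ := Int.eq_ofNat_of_zero_le hj
  obtain rfl : d = ((i + j : ℕ) : ℤ) := by push_cast; exact h.symm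
  exact tensor_d_proj K L i j (i + j) rfl

/-- The external product on cochains:
`u ∨ v = (-1)^(ij) (u ⊗ v) ∘ p`, with `p` the projection onto `Kᵢ ⊗ Lⱼ`. -/
def cochainProd (K L : ChainComplex C ℕ) {M N : C} {i j : ℤ} (d : ℤ)
    (u : (extendZ K).X i ⟶ M) (v : (extendZ L).X j ⟶ N) :
    (extendZ (HomologicalComplex.tensorObj K L)).X d ⟶ M ⊗ N :=
  (i * j).negOnePow • (projZ K L i j d ≫ (u ⊗ₘ v))

lemma d_cochainProd (K L : ChainComplex C ℕ) {M N : C} {i j d d' i' j' : ℤ} (h : i + j = d)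
    (h' : d + 1 = d') (hi : i + 1 = i') (hj : j + 1 = j')
    (u : (extendZ K).X i ⟶ M) (v : (extendZ L).X j ⟶ N) :
    (extendZ (HomologicalComplex.tensorObj K L)).d d' d ≫ cochainProd K L d u v =
      j.negOnePow • cochainProd K L d' ((extendZ K).d i' i ≫ u) v +
        cochainProd K L d' u ((extendZ L).d j' j ≫ v) := by
  subst hi hj
  simp only [cochainProd, Linear.comp_units_smul]
  rw [← Category.assoc, projZ_d K L i j d d' h h', Preadditive.add_comp, smul_add, smul_smul,
    Linear.units_smul_comp, smul_smul]
  congr 2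
  · rw [← Int.negOnePow_add, show j + (i + 1) * j = i * j + 2 * j by ring, Int.negOnePow_add,
      Int.negOnePow_two_mul, mul_one]
  · simp [MonoidalCategory.tensorHom_def]
  · rw [← Int.negOnePow_add]; congr 1; ring
  · simp [MonoidalCategory.tensorHom_def, whisker_exchange_assoc]

lemma cochainProd_add_left (K L : ChainComplex C ℕ) {M N : C} {i j : ℤ} (d : ℤ)
    (u u' : (extendZ K).X i ⟶ M) (v : (extendZ L).X j ⟶ N) :
    cochainProd K L d (u + u') v = cochainProd K L d u v + cochainProd K L d u' v := by
  simp [cochainProd, MonoidalPreadditive.add_tensor]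

lemma cochainProd_add_right (K L : ChainComplex C ℕ) {M N : C} {i j : ℤ} (d : ℤ)
    (u : (extendZ K).X i ⟶ M) (v v' : (extendZ L).X j ⟶ N) :
    cochainProd K L d u (v + v') = cochainProd K L d u v + cochainProd K L d u v' := by
  simp [cochainProd, MonoidalPreadditive.tensor_add]

lemma cochainProd_zero_left (K L : ChainComplex C ℕ) {M N : C} {i j : ℤ} (d : ℤ)
    (v : (extendZ L).X j ⟶ N) :
    cochainProd K L d (0 : (extendZ K).X i ⟶ M) v = 0 := by
  simp [cochainProd]

lemma cochainProd_zero_right (K L : ChainComplex C ℕ) {M N : C} {i j : ℤ} (d : ℤ)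
    (u : (extendZ K).X i ⟶ M) :
    cochainProd K L d u (0 : (extendZ L).X j ⟶ N) = 0 := by
  simp [cochainProd]

lemma cochainProd_smul_left (K L : ChainComplex C ℕ) {M N : C} {i j : ℤ} (d : ℤ) (s : ℤˣ)
    (u : (extendZ K).X i ⟶ M) (v : (extendZ L).X j ⟶ N) :
    cochainProd K L d (s • u) v = s • cochainProd K L d u v := by
  rcases Int.units_eq_one_or s with rfl | rfl
  · simp
  · simp only [Units.neg_smul, one_smul]
    rw [eq_neg_iff_add_eq_zero, ← cochainProd_add_left, neg_add_cancel, cochainProd_zero_left]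

lemma cochainProd_smul_right (K L : ChainComplex C ℕ) {M N : C} {i j : ℤ} (d : ℤ) (s : ℤˣ)
    (u : (extendZ K).X i ⟶ M) (v : (extendZ L).X j ⟶ N) :
    cochainProd K L d u (s • v) = s • cochainProd K L d u v := by
  rcases Int.units_eq_one_or s with rfl | rfl
  · simp
  · simp only [Units.neg_smul, one_smul]
    rw [eq_neg_iff_add_eq_zero, ← cochainProd_add_right, neg_add_cancel, cochainProd_zero_right]

lemma cochainProd_comp (K L : ChainComplex C ℕ) {M N M' N' : C} {i j : ℤ} (d : ℤ)
    (u : (extendZ K).X i ⟶ M) (v : (extendZ L).X j ⟶ N) (a : M ⟶ M') (b : N ⟶ N') :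
    cochainProd K L d u v ≫ (a ⊗ₘ b) = cochainProd K L d (u ≫ a) (v ≫ b) := by
  simp [cochainProd, Linear.units_smul_comp]

lemma cochainProd_mem (K L : ChainComplex C ℕ) {M N : C} {i j d : ℤ} (h : i + j = d)
    (u : cocycles (extendZ K) M i) (v : cocycles (extendZ L) N j) :
    cochainProd K L d u.1 v.1 ∈
      cocycles (extendZ (HomologicalComplex.tensorObj K L)) (M ⊗ N) d := by
  intro d'
  by_cases h' : d + 1 = d'
  · rw [d_cochainProd K L h h' rfl rfl, u.2, v.2, cochainProd_zero_left, cochainProd_zero_right,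
      smul_zero, add_zero]
  · rw [(extendZ _).shape _ _ h', zero_comp]

/-- The external product of cocycles, with values in cohomology. -/
def cocycleProd (K L : ChainComplex C ℕ) (M N : C) {i j d : ℤ} (h : i + j = d)
    (u : cocycles (extendZ K) M i) :
    cocycles (extendZ L) N j →+
      ExtGroup (extendZ (HomologicalComplex.tensorObj K L)) (M ⊗ N) d :=
  AddMonoidHom.mk' (fun v => ExtGroup.mk ⟨_, cochainProd_mem K L h u v⟩) (fun v v' =>
    congrArg QuotientAddGroup.mk (Subtype.ext (cochainProd_add_right _ _ _ _ _ _)))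


lemma cochainProd_bdry_right (K L : ChainComplex C ℕ) {M N : C} {i j d : ℤ} (h : i + j = d)
    (u : cocycles (extendZ K) M i) (v : (extendZ L).X j ⟶ N)
    (hv : ∃ w : (extendZ L).X (j - 1) ⟶ N, v = (extendZ L).d j (j - 1) ≫ w) :
    ∃ w, cochainProd K L d u.1 v =
      (extendZ (HomologicalComplex.tensorObj K L)).d d (d - 1) ≫ w := by
  obtain ⟨w, rfl⟩ := hv
  refine ⟨cochainProd K L (d - 1) u.1 w, ?_⟩
  rw [d_cochainProd K L (i' := i + 1) (j' := j) (by omega) (by omega) rfl (by omega),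
    u.2, cochainProd_zero_left, smul_zero, zero_add]

lemma cochainProd_bdry_left (K L : ChainComplex C ℕ) {M N : C} {i j d : ℤ} (h : i + j = d)
    (u : (extendZ K).X i ⟶ M) (v : cocycles (extendZ L) N j)
    (hu : ∃ w : (extendZ K).X (i - 1) ⟶ M, u = (extendZ K).d i (i - 1) ≫ w) :
    ∃ w, cochainProd K L d u v.1 =
      (extendZ (HomologicalComplex.tensorObj K L)).d d (d - 1) ≫ w := by
  obtain ⟨w, rfl⟩ := hu
  refine ⟨j.negOnePow • cochainProd K L (d - 1) w v.1, ?_⟩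
  rw [Linear.comp_units_smul,
    d_cochainProd K L (i' := i) (j' := j + 1) (by omega) (by omega) (by omega) rfl,
    v.2, cochainProd_zero_right, add_zero, smul_smul, Int.units_mul_self, one_smul]

/-- The external product with a fixed cocycle. -/
def extProdLeft (K L : ChainComplex C ℕ) (M N : C) {i j d : ℤ} (h : i + j = d)
    (u : cocycles (extendZ K) M i) :
    ExtGroup (extendZ L) N j →+
      ExtGroup (extendZ (HomologicalComplex.tensorObj K L)) (M ⊗ N) d :=
  QuotientAddGroup.lift _ (cocycleProd K L M N h u) (fun v hv =>
    ExtGroup.mk_eq_zero _ (cochainProd_bdry_right K L h u v.1 hv))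

lemma extProdLeft_mk (K L : ChainComplex C ℕ) (M N : C) {i j d : ℤ} (h : i + j = d)
    (u : cocycles (extendZ K) M i) (v : cocycles (extendZ L) N j) :
    extProdLeft K L M N h u (ExtGroup.mk v) = ExtGroup.mk ⟨_, cochainProd_mem K L h u v⟩ := rfl

lemma extProdLeft_add (K L : ChainComplex C ℕ) (M N : C) {i j d : ℤ} (h : i + j = d)
    (u u' : cocycles (extendZ K) M i) :
    extProdLeft K L M N h (u + u') = extProdLeft K L M N h u + extProdLeft K L M N h u' := by
  refine AddMonoidHom.ext fun y => ?_
  obtain ⟨v, rfl⟩ := ExtGroup.mk_surjective y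
  rw [AddMonoidHom.add_apply, extProdLeft_mk, extProdLeft_mk, extProdLeft_mk, ← ExtGroup.mk_add]
  exact ExtGroup.mk_congr (cochainProd_add_left K L d u.1 u'.1 v.1)

lemma extProdLeft_bdry (K L : ChainComplex C ℕ) (M N : C) {i j d : ℤ} (h : i + j = d)
    (u : cocycles (extendZ K) M i) (hu : u ∈ coboundaries (extendZ K) M i) :
    extProdLeft K L M N h u = 0 := by
  refine AddMonoidHom.ext fun y => ?_
  obtain ⟨v, rfl⟩ := ExtGroup.mk_surjective y
  exact ExtGroup.mk_eq_zero _ (cochainProd_bdry_left K L h u.1 v hu)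

/-- The external product as a biadditive map. -/
def extProdAux (K L : ChainComplex C ℕ) (M N : C) {i j d : ℤ} (h : i + j = d) :
    ExtGroup (extendZ K) M i →+ ExtGroup (extendZ L) N j →+
      ExtGroup (extendZ (HomologicalComplex.tensorObj K L)) (M ⊗ N) d :=
  QuotientAddGroup.lift _ (AddMonoidHom.mk' (extProdLeft K L M N h) (extProdLeft_add K L M N h))
    (fun u hu => extProdLeft_bdry K L M N h u hu)

/-- The external product
`∨ : Extⁱ(A, M) ⊗ Extʲ(C, N) → Extⁱ⁺ʲ(A ⊗ C, M ⊗ N)` for complexes `K` and `L` resolving `A`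
and `C`. -/
def extProd (K L : ChainComplex C ℕ) (M N : C) {i j d : ℤ} (h : i + j = d) :
    ExtGroup (extendZ K) M i ⊗[ℤ] ExtGroup (extendZ L) N j →+
      ExtGroup (extendZ (HomologicalComplex.tensorObj K L)) (M ⊗ N) d :=
  TensorProduct.liftAddHom (extProdAux K L M N h)
    (fun r m n => by rw [map_zsmul]; exact (map_zsmul (extProdAux K L M N h m) r n).symm)

lemma extProd_mk (K L : ChainComplex C ℕ) (M N : C) {i j d : ℤ} (h : i + j = d)
    (u : cocycles (extendZ K) M i) (v : cocycles (extendZ L) N j) :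
    extProd K L M N h (ExtGroup.mk u ⊗ₜ ExtGroup.mk v) =
      ExtGroup.mk ⟨_, cochainProd_mem K L h u v⟩ :=
  (TensorProduct.liftAddHom_tmul _ _ _ _).trans (extProdLeft_mk K L M N h u v)

/-- A convenient form of `extProd_mk`. -/
lemma extProd_mk_eq (K L : ChainComplex C ℕ) (M N : C) {i j d : ℤ} (h : i + j = d)
    (u : cocycles (extendZ K) M i) (v : cocycles (extendZ L) N j)
    (z : cocycles (extendZ (HomologicalComplex.tensorObj K L)) (M ⊗ N) d)
    (hz : z.1 = cochainProd K L d u.1 v.1) :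
    extProd K L M N h (ExtGroup.mk u ⊗ₜ ExtGroup.mk v) = ExtGroup.mk z :=
  (extProd_mk K L M N h u v).trans (ExtGroup.mk_congr hz.symm)

/-- External products are compatible with connecting homomorphisms in the first variable. -/
lemma extProd_delta_left (K L : ChainComplex C ℕ) [∀ i, Projective ((extendZ K).X i)]
    [∀ i, Projective ((extendZ (HomologicalComplex.tensorObj K L)).X i)]
    {S : ShortComplex C} (hS : S.ShortExact) (N : C) (w : S.f ▷ N ≫ S.g ▷ N = 0)
    (hT : (ShortComplex.mk (S.f ▷ N) (S.g ▷ N) w).ShortExact) {i i' j d d' : ℤ} (h : i + j = d)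
    (hi : i + 1 = i') (hd : d + 1 = d') (h' : i' + j = d')
    (x : ExtGroup (extendZ K) S.X₃ i) (y : ExtGroup (extendZ L) N j) :
    extProd K L S.X₁ N h' (delta hS hi x ⊗ₜ y) =
      delta hT hd (extProd K L S.X₃ N h (x ⊗ₜ y)) := by
  have := hS.epi_g
  have := hS.mono_f
  obtain ⟨u, rfl⟩ := ExtGroup.mk_surjective x
  obtain ⟨v, rfl⟩ := ExtGroup.mk_surjective y
  have e : (extendZ K).d i' i ≫ Projective.factorThru u.1 S.g ≫ S.g = 0 := by simp [u.2 i']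
  have e' := hS.exact.lift_f ((extendZ K).d i' i ≫ Projective.factorThru u.1 S.g)
    (by simpa using e)
  rw [delta_mk hS hi u _ _ ⟨_, delta_isCocycle hS _ _ _ e'⟩ (Projective.factorThru_comp _ _) e' rfl,
    extProd_mk, extProd_mk]
  refine (delta_mk hT hd _ (cochainProd K L d (Projective.factorThru u.1 S.g) v.1)
    (j.negOnePow • cochainProd K L d' (hS.exact.lift ((extendZ K).d i' i ≫ Projective.factorThru u.1 S.g)
    (by simpa using e)) v.1) _ ?_ ?_ ?_).symm
  · have := cochainProd_comp K L d (Projective.factorThru u.1 S.g) v.1 S.g (𝟙 N)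
    simpa using this
  · have := cochainProd_comp K L d' (hS.exact.lift
      ((extendZ K).d i' i ≫ Projective.factorThru u.1 S.g) (by simpa using e)) v.1 S.f (𝟙 N)
    rw [e', Category.comp_id, tensorHom_id] at this
    dsimp only
    rw [Linear.units_smul_comp, this, d_cochainProd K L h hd hi rfl, v.2, cochainProd_zero_right,
      add_zero]
  · dsimp only
    rw [cochainProd_smul_left, smul_smul, ← Int.negOnePow_add]
    congr 1
    rw [Int.negOnePow_eq_iff]
    exact ⟨-j, by omega⟩

/-- External products are compatible with connecting homomorphisms in the second variable, up to
sign. -/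
lemma extProd_delta_right (K L : ChainComplex C ℕ) [∀ i, Projective ((extendZ L).X i)]
    [∀ i, Projective ((extendZ (HomologicalComplex.tensorObj K L)).X i)]
    {S : ShortComplex C} (hS : S.ShortExact) (M : C) (w : M ◁ S.f ≫ M ◁ S.g = 0)
    (hT : (ShortComplex.mk (M ◁ S.f) (M ◁ S.g) w).ShortExact) {i j j' d d' : ℤ} (h : i + j = d)
    (hj : j + 1 = j') (hd : d + 1 = d') (h' : i + j' = d')
    (x : ExtGroup (extendZ K) M i) (y : ExtGroup (extendZ L) S.X₃ j) :
    extProd K L M S.X₁ h' (x ⊗ₜ delta hS hj y) =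
      i.negOnePow • delta hT hd (extProd K L M S.X₃ h (x ⊗ₜ y)) := by
  have := hS.epi_g
  have := hS.mono_f
  obtain ⟨u, rfl⟩ := ExtGroup.mk_surjective x
  obtain ⟨v, rfl⟩ := ExtGroup.mk_surjective y
  have e : (extendZ L).d j' j ≫ Projective.factorThru v.1 S.g ≫ S.g = 0 := by simp [v.2 j']
  have e' := hS.exact.lift_f ((extendZ L).d j' j ≫ Projective.factorThru v.1 S.g)
    (by simpa using e)
  rw [delta_mk hS hj v _ _ ⟨_, delta_isCocycle hS _ _ _ e'⟩ (Projective.factorThru_comp _ _) e' rfl,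
    extProd_mk, extProd_mk]
  have c := cochainProd_comp K L d' u.1 (hS.exact.lift
      ((extendZ L).d j' j ≫ Projective.factorThru v.1 S.g) (by simpa using e)) (𝟙 M) S.f 
  have c' := cochainProd_comp K L d u.1 (Projective.factorThru v.1 S.g) (𝟙 M) S.g
  rw [e', Category.comp_id, id_tensorHom] at c
  rw [Projective.factorThru_comp, Category.comp_id, id_tensorHom] at c'
  have b : cochainProd K L d' u.1 (hS.exact.lift
      ((extendZ L).d j' j ≫ Projective.factorThru v.1 S.g) (by simpa using e)) ≫ M ◁ S.f =
      (extendZ (HomologicalComplex.tensorObj K L)).d d' d ≫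
        cochainProd K L d u.1 (Projective.factorThru v.1 S.g) := by
    rw [c, d_cochainProd K L h hd rfl hj, u.2, cochainProd_zero_left, smul_zero, zero_add]
  rw [delta_mk hT hd _ _ _ ⟨_, delta_isCocycle hT (d + 1).negOnePow _ _ b⟩ c' b rfl,
    ← ExtGroup.mk_units_smul i.negOnePow _ _ ?_]
  dsimp only
  rw [cochainProd_smul_right]
  rw [smul_smul, ← Int.negOnePow_add]
  congr 1
  rw [Int.negOnePow_eq_iff]
  exact ⟨-i, by omega⟩

variable (C) in
/-- The tensor product of two projective objects is projective. -/
class TensorProjective : Prop where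
  projective_tensor : ∀ P Q : C, Projective P → Projective Q → Projective (P ⊗ Q)

instance tensorObj_projective [TensorProjective C] (K L : ChainComplex C ℕ)
    [∀ i, Projective (K.X i)] [∀ i, Projective (L.X i)] (d : ℕ) :
    Projective ((HomologicalComplex.tensorObj K L).X d) where
  factors {E X} f e _ := by
    have h : ∀ i j, Projective (K.X i ⊗ L.X j) := fun i j =>
      TensorProjective.projective_tensor _ _ inferInstance inferInstance
    refine ⟨HomologicalComplex.mapBifunctorDesc (F := curriedTensor C) (fun i j hij =>
      haveI := h i j
      Projective.factorThru (P := K.X i ⊗ L.X j)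
        (HomologicalComplex.ιTensorObj K L i j d hij ≫ f) e), ?_⟩
    refine tensor_hom_ext' fun i j hij => ?_
    rw [← Category.assoc]
    refine (congrArg (· ≫ e) (HomologicalComplex.ι_mapBifunctorDesc _ _ _ _)).trans ?_
    have := h i j
    exact Projective.factorThru_comp (P := K.X i ⊗ L.X j) _ _

/-- The augmentation `P₀ ⟶ X` of a projective resolution. -/
def augmentation {X : C} (P : ProjectiveResolution X) : P.complex.X 0 ⟶ X :=
  (ChainComplex.toSingle₀Equiv P.complex X P.π).1

lemma d_augmentation {X : C} (P : ProjectiveResolution X) :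
    P.complex.d 1 0 ≫ augmentation P = 0 :=
  (ChainComplex.toSingle₀Equiv P.complex X P.π).2

lemma tensor_d_augmentation {X Y : C} (P : ProjectiveResolution X) (Q : ProjectiveResolution Y) :
    (HomologicalComplex.tensorObj P.complex Q.complex).d 1 0 ≫
      tensorProj P.complex Q.complex 0 0 0 ≫ (augmentation P ⊗ₘ augmentation Q) = 0 := by
  have h := tensor_d_proj P.complex Q.complex 0 0 0 rfl
  have e₁ : P.complex.d 1 0 ▷ Q.complex.X 0 ≫ (augmentation P ⊗ₘ augmentation Q) = 0 := by
    rw [MonoidalCategory.tensorHom_def, ← MonoidalCategory.comp_whiskerRight_assoc, d_augmentation,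
      MonoidalPreadditive.zero_whiskerRight, zero_comp]
  have e₂ : P.complex.X 0 ◁ Q.complex.d 1 0 ≫ (augmentation P ⊗ₘ augmentation Q) = 0 := by
    rw [MonoidalCategory.tensorHom_def', ← MonoidalCategory.whiskerLeft_comp_assoc, d_augmentation,
      MonoidalPreadditive.whiskerLeft_zero, zero_comp]
  rw [← Category.assoc]
  refine (congrArg (· ≫ (augmentation P ⊗ₘ augmentation Q)) h).trans ?_
  simp only [Preadditive.add_comp, Linear.units_smul_comp, Category.assoc]
  erw [e₁, e₂]
  simp

/-- The augmentation `(P ⊗ Q)₀ ⟶ X ⊗ Y` of the tensor product of two resolutions, which is the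
tensor product of the two augmentations. -/
def tensorAug {X Y : C} (P : ProjectiveResolution X) (Q : ProjectiveResolution Y) :
    HomologicalComplex.tensorObj P.complex Q.complex ⟶
      (ChainComplex.single₀ C).obj (X ⊗ Y) :=
  (ChainComplex.toSingle₀Equiv _ _).symm
    ⟨tensorProj P.complex Q.complex 0 0 0 ≫ (augmentation P ⊗ₘ augmentation Q),
      tensor_d_augmentation P Q⟩

/-- The tensor product of the two projective resolutions `P` of `X` and `Q` of `Y`, together with the
tensor product of the augmentations, is a resolution of `X ⊗ Y`. -/
def IsTensorResolution {X Y : C} (P : ProjectiveResolution X) (Q : ProjectiveResolution Y) :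
    Prop :=
  QuasiIso (tensorAug P Q)

/-- The projective resolution `P ⊗ Q` of `X ⊗ Y`. -/
abbrev tensorResolution [TensorProjective C] {X Y : C} (P : ProjectiveResolution X)
    (Q : ProjectiveResolution Y) (h : IsTensorResolution P Q) :
    ProjectiveResolution (X ⊗ Y) where
  complex := HomologicalComplex.tensorObj P.complex Q.complex
  projective _ := inferInstance
  hasHomology _ := inferInstance
  π := tensorAug P Q
  quasiIso := h

/-- The functors `F ⊗ -` and `- ⊗ F` are exact and preserve projectives. -/
structure TensorExact (F : C) : Prop where
  left_exact : ∀ S : ShortComplex C, S.ShortExact → (S.map (tensorLeft F)).ShortExact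
  right_exact : ∀ S : ShortComplex C, S.ShortExact → (S.map (tensorRight F)).ShortExact
  left_projective : ∀ P : C, Projective P → Projective (F ⊗ P)
  right_projective : ∀ P : C, Projective P → Projective (P ⊗ F)

namespace SplicedResolution

/-- All syzygies `Ω k`, including `Ω 0`, are such that `Ω k ⊗ -` and `- ⊗ Ω k` are exact and
preserve projectives. -/
def Admissible (Q : SplicedResolution C) : Prop :=
  ∀ k, TensorExact (Q.Ω k)

variable (B E : SplicedResolution C)

/-- The syzygy `Bₚ ⊗ E_q` of the interleaved resolution, for syzygies `Bₚ` and `E_q`. -/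
abbrev stageΩ (s : Stage) : C := B.Ω s.p ⊗ E.Ω s.q

/-- The projective terms of the interleaved resolution. -/
def stageP : Stage → C
  | ⟨p, q, true⟩ => B.P p ⊗ E.Ω q
  | ⟨p, q, false⟩ => B.Ω p ⊗ E.P q

/-- The inclusions of syzygies of the interleaved resolution. -/
def stageι : ∀ s : Stage, stageΩ B E s.next ⟶ stageP B E s
  | ⟨p, q, true⟩ => B.ι p ▷ E.Ω q
  | ⟨p, q, false⟩ => B.Ω p ◁ E.ι q

/-- The projections to syzygies of the interleaved resolution. -/
def stageπ : ∀ s : Stage, stageP B E s ⟶ stageΩ B E s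
  | ⟨p, q, true⟩ => B.π p ▷ E.Ω q
  | ⟨p, q, false⟩ => B.Ω p ◁ E.π q

lemma stage_w : ∀ s : Stage, stageι B E s ≫ stageπ B E s = 0
  | ⟨p, q, true⟩ => 
    (MonoidalCategory.comp_whiskerRight (B.ι p) (B.π p) (E.Ω q)).symm.trans
      ((congrArg (· ▷ E.Ω q) (B.w p)).trans MonoidalPreadditive.zero_whiskerRight)
  | ⟨p, q, false⟩ => 
    (MonoidalCategory.whiskerLeft_comp (B.Ω p) (E.ι q) (E.π q)).symm.trans
      ((congrArg (B.Ω p ◁ ·) (E.w q)).trans MonoidalPreadditive.whiskerLeft_zero)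

variable {B E}

lemma stage_shortExact (hB : B.Admissible) (hE : E.Admissible) :
    ∀ s : Stage, (ShortComplex.mk (stageι B E s) (stageπ B E s) (stage_w B E s)).ShortExact
  | ⟨p, q, true⟩ => (hE q).right_exact _ (B.shortExact p)
  | ⟨p, q, false⟩ => (hB p).left_exact _ (E.shortExact q)

lemma stage_projective (hB : B.Admissible) (hE : E.Admissible) :
    ∀ s : Stage, Projective (stageP B E s)
  | ⟨p, q, true⟩ => (hE q).right_projective _ (B.projective p)
  | ⟨p, q, false⟩ => (hB p).left_projective _ (E.projective q)

/-- The projective resolution of `B ⊗ E` that is spliced from the short exact sequences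
`0 → Bₚ₊₁ ⊗ E_q → Pₚ ⊗ E_q → Bₚ ⊗ E_q → 0` and `0 → Bₚ ⊗ E_{q+1} → Bₚ ⊗ P_q → Bₚ ⊗ E_q → 0`
in turns, where `Bₚ`, `E_q` are the syzygies of the given resolutions of `B` and `E`. -/
def interleave (hB : B.Admissible) (hE : E.Admissible) : SplicedResolution C where
  Ω j := stageΩ B E (path j)
  P j := stageP B E (path j)
  ι j := stageι B E (path j)
  π j := stageπ B E (path j)
  w j := stage_w B E (path j)
  shortExact j := stage_shortExact hB hE (path j)
  projective j := stage_projective hB hE (path j)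

end SplicedResolution

section Products

variable {X Y : C} (P : ProjectiveResolution X) (Q : ProjectiveResolution Y)
  (B E : SplicedResolution C) (m n : ℤ)

/-- The signs of the system `Extᵐ⁺ᵖ(X, Bₚ) ⊗ Extⁿ⁺q(Y, E_q)`: the transition maps are `δ ⊗ id` and
`(-1)ᵐ⁺ᵖ id ⊗ δ`. -/
def leftSign (s : Stage) : ℤˣ :=
  if s.dir then 1 else (m + s.p).negOnePow

/-- The signs of the system `Extⁿ⁺q(Y, E_q) ⊗ Extᵐ⁺ᵖ(X, Bₚ)`: the transition maps are
`(-1)ⁿ⁺q id ⊗ δ` and `δ ⊗ id`. -/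
def rightSign (s : Stage) : ℤˣ :=
  if s.dir then (n + s.q).negOnePow else 1

variable {B E}

lemma extProd_stepMap [TensorProjective C] (hB : B.Admissible) (hE : E.Admissible) :
    ∀ (s : Stage) {d d' : ℤ} (h : (m + s.p) + (n + s.q) = d)
      (h' : (m + s.next.p) + (n + s.next.q) = d') (hd : d + 1 = d')
      (z : ExtOf P (B.Ω s.p) (m + s.p) ⊗[ℤ] ExtOf Q (E.Ω s.q) (n + s.q)),
      extProd P.complex Q.complex (B.Ω s.next.p) (E.Ω s.next.q) h'
        (stepMap (syzygyDelta P B m) (syzygyDelta Q E n) (leftSign m) s z) =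
      delta (SplicedResolution.stage_shortExact hB hE s) hd
        (extProd P.complex Q.complex (B.Ω s.p) (E.Ω s.q) h z)
  | ⟨p, q, true⟩, d, d', h, h', hd, z => by
    induction z using TensorProduct.induction_on with
    | zero => simp only [map_zero]
    | add a b ha hb => simp only [map_add, ha, hb]
    | tmul x y =>
      refine Eq.trans ?_ (extProd_delta_left P.complex Q.complex (B.shortExact p) (E.Ω q) _
        (SplicedResolution.stage_shortExact hB hE ⟨p, q, true⟩) h
        (i' := m + (p + 1 : ℕ)) (by push_cast; ring) hd h' x y)
      simp only [stepMap, leftSign, if_true, one_smul]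
      rfl
  | ⟨p, q, false⟩, d, d', h, h', hd, z => by
    induction z using TensorProduct.induction_on with
    | zero => simp only [map_zero]
    | add a b ha hb => simp only [map_add, ha, hb]
    | tmul x y =>
      have e := extProd_delta_right P.complex Q.complex (E.shortExact q) (B.Ω p) _
        (SplicedResolution.stage_shortExact hB hE ⟨p, q, false⟩) h
        (j' := n + (q + 1 : ℕ)) (by push_cast; ring) hd h' x y
      have e' := congrArg (fun t => (m + p).negOnePow • t) e
      simp only [smul_smul, Int.units_mul_self, one_smul] at e'
      refine Eq.trans ?_ e'
      simp only [stepMap, leftSign]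
      rw [Units.smul_def, Units.smul_def, ← map_zsmul]
      rfl

variable {m n} in
lemma path_degree {d : ℤ} (h : m + n = d) (j : ℕ) :
    (m + (path j).p) + (n + (path j).q) = d + (j : ℕ) := by
  have := path_sum j
  omega

/-- The external product
`∨ : Êxtᵐ(X, B) ⊗ Êxtⁿ(Y, E) → Êxtᵐ⁺ⁿ(X ⊗ Y, B ⊗ E)`.
It is the direct limit of the external products
`Extᵐ⁺ᵖ(X, Bₚ) ⊗ Extⁿ⁺q(Y, E_q) → Extᵐ⁺ⁿ⁺ʲ(X ⊗ Y, Bₚ ⊗ E_q)` over the points `(p, q)` of the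
staircase path, `j = p + q`. The transition maps on the left are `δ ⊗ id` and `(-1)ᵐ⁺ᵖ id ⊗ δ`, and
those on the right are connecting homomorphisms. -/
def extHatProd [TensorProjective C] (hPQ : IsTensorResolution P Q) (hB : B.Admissible)
    (hE : E.Admissible) (m n d : ℤ) (h : m + n = d) :
    ExtHat P B m ⊗[ℤ] ExtHat Q E n →+
      ExtHat (tensorResolution P Q hPQ) (SplicedResolution.interleave hB hE) d :=
  (SeqColim.map (stairStep (syzygyDelta P B m) (syzygyDelta Q E n) (leftSign m))
      (syzygyDelta (tensorResolution P Q hPQ) (SplicedResolution.interleave hB hE) d)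
      (fun j => extProd P.complex Q.complex (B.Ω (path j).p) (E.Ω (path j).q) (path_degree h j))
      (fun j z => extProd_stepMap P Q m n hB hE (path j) (path_degree h j)
        (path_degree h (j + 1)) _ z)).comp
    (stairEquiv (syzygyDelta P B m) (syzygyDelta Q E n) (leftSign m)).symm.toAddMonoidHom

variable (B E)

/-- The homomorphism
`(-1)^(ij) swap : Extⁱ(X, M) ⊗ Extʲ(Y, N) → Extʲ(Y, N) ⊗ Extⁱ(X, M)`, `x ⊗ y ↦ (-1)^(ij) y ⊗ x`. -/
def signedSwap (M N : C) (i j : ℤ) :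
    ExtOf P M i ⊗[ℤ] ExtOf Q N j →+ ExtOf Q N j ⊗[ℤ] ExtOf P M i :=
  (i * j).negOnePow • (TensorProduct.comm ℤ (ExtOf P M i) (ExtOf Q N j)).toLinearMap.toAddMonoidHom

@[simp]
lemma signedSwap_tmul (M N : C) (i j : ℤ) (x : ExtOf P M i) (y : ExtOf Q N j) :
    signedSwap P Q M N i j (x ⊗ₜ y) = (i * j).negOnePow • (y ⊗ₜ[ℤ] x) := rfl

/-- The terms `Extⁿ⁺q(Y, E_q) ⊗ Extᵐ⁺ᵖ(X, Bₚ)` of the system on the right. -/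
abbrev rightTerm (s : Stage) : Type v :=
  ExtOf Q (E.Ω s.q) (n + s.q) ⊗[ℤ] ExtOf P (B.Ω s.p) (m + s.p)

/-- The transition maps `(-1)ⁿ⁺q id ⊗ δ` and `δ ⊗ id` of the system on the right. -/
def rightStepMap : ∀ s : Stage, rightTerm P Q B E m n s →+ rightTerm P Q B E m n s.next
  | ⟨p, q, true⟩ => rightSign n ⟨p, q, true⟩ •
      tensorMap (AddMonoidHom.id (ExtOf Q (E.Ω q) (n + q))) (syzygyDelta P B m p)
  | ⟨p, q, false⟩ => rightSign n ⟨p, q, false⟩ •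
      tensorMap (syzygyDelta Q E n q) (AddMonoidHom.id (ExtOf P (B.Ω p) (m + p)))

/-- The system
`Extⁿ(Y, E₀) ⊗ Extᵐ(X, B₀) → Extⁿ(Y, E₀) ⊗ Extᵐ⁺¹(X, B₁) → Extⁿ⁺¹(Y, E₁) ⊗ Extᵐ⁺¹(X, B₁) → ⋯`. -/
def rightStep (j : ℕ) :
    rightTerm P Q B E m n (path j) →+ rightTerm P Q B E m n (path (j + 1)) :=
  rightStepMap P Q B E m n (path j)

/-- The direct limit of the system on the right. -/
abbrev RightColim : Type v :=
  SeqColim (G := fun j => rightTerm P Q B E m n (path j)) (rightStep P Q B E m n)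

/-- The canonical homomorphism of the terms on the right to the tensor product of completed
Ext-groups. -/
def rightOf (s : Stage) : rightTerm P Q B E m n s →+ ExtHat Q E n ⊗[ℤ] ExtHat P B m :=
  tensorMap (ExtHat.of Q E n s.q) (ExtHat.of P B m s.p)

lemma map_units_smul {M N : Type*} [AddCommGroup M] [AddCommGroup N] (a : M →+ N) (s : ℤˣ)
    (x : M) : a (s • x) = s • a x := by
  rw [Units.smul_def, Units.smul_def, map_zsmul]

lemma rightOf_rightStepMap : ∀ (s : Stage) (z : rightTerm P Q B E m n s),
    rightOf P Q B E m n s.next (rightStepMap P Q B E m n s z) =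
      rightSign n s • rightOf P Q B E m n s z
  | ⟨p, q, true⟩, z => by
    induction z using TensorProduct.induction_on with
    | zero => simp only [map_zero, smul_zero]
    | add a b ha hb => simp only [map_add, ha, hb, smul_add]
    | tmul x y =>
      refine (map_units_smul (rightOf P Q B E m n ⟨p + 1, q, false⟩)
        (rightSign n ⟨p, q, true⟩) (x ⊗ₜ[ℤ] syzygyDelta P B m p y)).trans ?_
      refine congrArg (fun t : ExtHat P B m => rightSign n ⟨p, q, true⟩ • (ExtHat.of Q E n q x ⊗ₜ[ℤ] t)) ?_
      exact SeqColim.of_succ (syzygyDelta P B m) p y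
  | ⟨p, q, false⟩, z => by
    induction z using TensorProduct.induction_on with
    | zero => simp only [map_zero, smul_zero]
    | add a b ha hb => simp only [map_add, ha, hb, smul_add]
    | tmul x y =>
      refine (map_units_smul (rightOf P Q B E m n ⟨p, q + 1, true⟩)
        (rightSign n ⟨p, q, false⟩) (syzygyDelta Q E n q x ⊗ₜ[ℤ] y)).trans ?_
      refine congrArg (fun t : ExtHat Q E n => rightSign n ⟨p, q, false⟩ • (t ⊗ₜ[ℤ] ExtHat.of P B m p y)) ?_
      exact SeqColim.of_succ (syzygyDelta Q E n) q x

/-- The comparison of the direct limit of the system on the right with the tensor product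
`Êxtⁿ(Y, E) ⊗ Êxtᵐ(X, B)`. On the `j`-th term it is the tensor product of the canonical maps,
multiplied with the accumulated sign, so that the signs of the transition maps cancel. -/
def rightToTensor : RightColim P Q B E m n →+ ExtHat Q E n ⊗[ℤ] ExtHat P B m :=
  SeqColim.desc _ (fun j => totalSign (rightSign n) j • rightOf P Q B E m n (path j))
    (fun j z => by
      have h := rightOf_rightStepMap P Q B E m n (path j) z
      simp only [AddMonoidHom.smul_apply]
      rw [totalSign, Finset.prod_range_succ, mul_smul]
      refine congrArg (fun t => totalSign (rightSign n) j • t) ?_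
      refine (congrArg (fun t => rightSign n (path j) • t) h).trans ?_
      rw [smul_smul, Int.units_mul_self, one_smul])

lemma signedSwap_stepMap : ∀ (s : Stage)
    (z : ExtOf P (B.Ω s.p) (m + s.p) ⊗[ℤ] ExtOf Q (E.Ω s.q) (n + s.q)),
    signedSwap P Q (B.Ω s.next.p) (E.Ω s.next.q) (m + s.next.p) (n + s.next.q)
        (stepMap (syzygyDelta P B m) (syzygyDelta Q E n) (leftSign m) s z) =
      rightStepMap P Q B E m n s (signedSwap P Q (B.Ω s.p) (E.Ω s.q) (m + s.p) (n + s.q) z)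
  | ⟨p, q, true⟩, z => by
    induction z using TensorProduct.induction_on with
    | zero => simp only [map_zero]
    | add a b ha hb => simp only [map_add, ha, hb]
    | tmul x y =>
      refine (map_units_smul _ (leftSign m ⟨p, q, true⟩) (syzygyDelta P B m p x ⊗ₜ[ℤ] y)).trans
        (Eq.trans ?_ (map_units_smul (rightStepMap P Q B E m n ⟨p, q, true⟩) _ (y ⊗ₜ[ℤ] x)).symm)
      change leftSign m ⟨p, q, true⟩ • ((m + (p + 1 : ℕ)) * (n + q)).negOnePow •
          (y ⊗ₜ[ℤ] syzygyDelta P B m p x) =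
        ((m + p) * (n + q)).negOnePow • rightSign n ⟨p, q, true⟩ •
          (y ⊗ₜ[ℤ] syzygyDelta P B m p x)
      simp only [leftSign, rightSign, if_true, one_smul]
      rw [smul_smul, ← Int.negOnePow_add]
      congr 2
      push_cast
      ring
  | ⟨p, q, false⟩, z => by
    induction z using TensorProduct.induction_on with
    | zero => simp only [map_zero]
    | add a b ha hb => simp only [map_add, ha, hb]
    | tmul x y =>
      refine (map_units_smul _ (leftSign m ⟨p, q, false⟩) (x ⊗ₜ[ℤ] syzygyDelta Q E n q y)).trans
        (Eq.trans ?_ (map_units_smul (rightStepMap P Q B E m n ⟨p, q, false⟩) _ (y ⊗ₜ[ℤ] x)).symm)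
      change leftSign m ⟨p, q, false⟩ • ((m + p) * (n + (q + 1 : ℕ))).negOnePow •
          (syzygyDelta Q E n q y ⊗ₜ[ℤ] x) =
        ((m + p) * (n + q)).negOnePow • rightSign n ⟨p, q, false⟩ •
          (syzygyDelta Q E n q y ⊗ₜ[ℤ] x)
      simp only [leftSign, rightSign, if_false, one_smul, Bool.false_eq_true]
      rw [smul_smul, ← Int.negOnePow_add]
      congr 1
      rw [Int.negOnePow_eq_iff]
      exact ⟨m + p, by push_cast; ring⟩

/-- The homomorphism `Êxtᵐ(X, B) ⊗ Êxtⁿ(Y, E) → Êxtⁿ(Y, E) ⊗ Êxtᵐ(X, B)` that is the direct limit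
of the homomorphisms
`(-1)^((m+p)(n+q)) swap : Extᵐ⁺ᵖ(X, Bₚ) ⊗ Extⁿ⁺q(Y, E_q) → Extⁿ⁺q(Y, E_q) ⊗ Extᵐ⁺ᵖ(X, Bₚ)`. -/
def swapHat : ExtHat P B m ⊗[ℤ] ExtHat Q E n →+ ExtHat Q E n ⊗[ℤ] ExtHat P B m :=
  ((rightToTensor P Q B E m n).comp
    (SeqColim.map (stairStep (syzygyDelta P B m) (syzygyDelta Q E n) (leftSign m))
      (rightStep P Q B E m n)
      (fun j => signedSwap P Q (B.Ω (path j).p) (E.Ω (path j).q) (m + (path j).p)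
        (n + (path j).q))
      (fun j z => signedSwap_stepMap P Q B E m n (path j) z))).comp
    (stairEquiv (syzygyDelta P B m) (syzygyDelta Q E n) (leftSign m)).symm.toAddMonoidHom

end Products

section Cup

/-- The cup product
`⌣ : Êxtᵐ(𝟙, M) ⊗ Êxtⁿ(𝟙, N) → Êxtᵐ⁺ⁿ(𝟙, M ⊗ N)`: the external product followed by the
homomorphism that the isomorphism `𝟙 ≅ 𝟙 ⊗ 𝟙` induces. -/
def cupProd [TensorProjective C] (R : ProjectiveResolution (𝟙_ C)) (hR : IsTensorResolution R R)
    {M N : SplicedResolution C} (hM : M.Admissible) (hN : N.Admissible) (m n d : ℤ)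
    (h : m + n = d) :
    ExtHat R M m ⊗[ℤ] ExtHat R N n →+ ExtHat R (SplicedResolution.interleave hM hN) d :=
  (ExtHat.map (tensorResolution R R hR) R (SplicedResolution.interleave hM hN)
    (SplicedResolution.interleave hM hN) (λ_ (𝟙_ C)).inv (𝟙 _) d).comp
    (extHatProd R R hR hM hN m n d h)

end Cup

end Tensor

end

end CompletedExt

open CompletedExt

/-!
Why external products in completed `Ext` commute up to the swaps `σ : X ⊗ Y ≅ Y ⊗ X`.

On cochains the signed swap of complexes, `x ⊗ y ↦ (-1)^(ij) y ⊗ x`, is an isomorphism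
`P ⊗ Q ≅ Q ⊗ P` over the swap of the augmentations. It turns the external product of `u` and `v` into
`(-1)^(ij)` times that of `v` and `u` (`map_swap_extProd`), and it shows that `Q ⊗ P` is a resolution if
`P ⊗ Q` is (`IsTensorResolution.swap`). Since homotopic chain maps agree on `Ext`
(`ExtGroup.map_eq_of_homotopy`), this chain map computes the effect of the swap in the first variable.

In the second variable, the interleaved resolutions of `B ⊗ E` and `E ⊗ B` go from the stage `(k, k)`
to `(k + 1, k + 1)` by the two steps in opposite orders, and iterated connecting homomorphisms
anticommute. So the lift of the swap of `B ⊗ E` is `(-1)^k σ` on the syzygies at the stage `(k, k)`, up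
to a morphism that factors through a projective term of the target
(`SplicedResolution.isStableSwap_lift`, from `SplicedResolution.stable_swap_double_step`). Such a
morphism induces a map of `Ext`-groups that the next connecting homomorphism kills
(`delta_map_comp_g`), so it is invisible in the direct limit.

The swap of completed `Ext`-groups can be compared with these formulas on the stages `(k, k)` with
`4 ∣ k`, which are cofinal: there all accumulated signs of the staircase systems are `1`
(`totalSign_leftSign`, `totalSign_rightSign`), and so is `(-1)^k`. This proves
`map_swap_comp_extHatProd`. The statement on cup products follows from functoriality of completed
`Ext` (`ExtHat.map_comp_map`), once `R ⊗ R` is known to be a resolution of `𝟙 ⊗ 𝟙`. By exactness and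
faithfulness of the functor to `D` this can be checked in `D`, where `𝟙` becomes projective: its
resolution is then homotopy equivalent to a complex in degree zero, and tensor products preserve
homotopy equivalences (`isTensorResolution_of_map_projective`).
-/

/-! ### Completed `Ext`: homotopy invariance, stability and functoriality -/

namespace CompletedExt

noncomputable section

section ExtLemmas

lemma SeqColim.map_of {G H : ℕ → Type v} [∀ k, AddCommGroup (G k)] [∀ k, AddCommGroup (H k)]
    (f : ∀ k, G k →+ G (k + 1)) (g : ∀ k, H k →+ H (k + 1)) (a : ∀ k, G k →+ H k)
    (ha : ∀ k x, a (k + 1) (f k x) = g k (a k x)) (k : ℕ) (x : G k) :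
    SeqColim.map f g a ha (SeqColim.of f k x) = SeqColim.of g k (a k x) :=
  SeqColim.desc_of _ _ _ _ _

variable {C : Type u} [Category.{v} C] [Abelian C]

lemma mk_eq_zero_of_eq_d_comp {K : ChainComplex C ℤ} {M : C} {n : ℤ} (u : cocycles K M n) (j : ℤ)
    (w : K.X j ⟶ M) (h : u.1 = K.d n j ≫ w) : ExtGroup.mk u = 0 := by
  refine ExtGroup.mk_eq_zero u ?_
  by_cases hj : j + 1 = n
  · obtain rfl : j = n - 1 := by omega
    exact ⟨w, h⟩
  · exact ⟨0, by rw [h, K.shape _ _ hj, zero_comp, comp_zero]⟩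

lemma ExtGroup.mk_sub {K : ChainComplex C ℤ} {M : C} {n : ℤ} (u v : cocycles K M n) :
    ExtGroup.mk (u - v) = ExtGroup.mk u - ExtGroup.mk v := rfl

/-- The cocycle that represents the image of a class under `ExtGroup.map`. -/
def cocycles.map {K L : ChainComplex C ℤ} {M N : C} (φ : L ⟶ K) (f : M ⟶ N) {n : ℤ}
    (u : cocycles K M n) : cocycles L N n :=
  ⟨φ.f n ≫ u.1 ≫ f, fun j => by
    rw [← φ.comm_assoc, reassoc_of% (u.2 j), zero_comp, comp_zero]⟩

lemma ExtGroup.map_mk' {K L : ChainComplex C ℤ} {M N : C} (φ : L ⟶ K) (f : M ⟶ N) {n : ℤ}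
    (u : cocycles K M n) :
    ExtGroup.map φ f n (ExtGroup.mk u) = ExtGroup.mk (cocycles.map φ f u) := rfl

lemma ExtGroup.map_map {K L N : ChainComplex C ℤ} {X Y Z : C} (φ : L ⟶ K) (ψ : N ⟶ L)
    (f : X ⟶ Y) (g : Y ⟶ Z) (n : ℤ) (x : ExtGroup K X n) :
    ExtGroup.map ψ g n (ExtGroup.map φ f n x) = ExtGroup.map (ψ ≫ φ) (f ≫ g) n x := by
  obtain ⟨u, rfl⟩ := ExtGroup.mk_surjective x
  exact ExtGroup.mk_congr (by simp)

lemma ExtGroup.map_add_right {K L : ChainComplex C ℤ} {M N : C} (φ : L ⟶ K) (f g : M ⟶ N) (n : ℤ)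
    (x : ExtGroup K M n) :
    ExtGroup.map φ (f + g) n x = ExtGroup.map φ f n x + ExtGroup.map φ g n x := by
  obtain ⟨u, rfl⟩ := ExtGroup.mk_surjective x
  rw [ExtGroup.map_mk', ExtGroup.map_mk', ExtGroup.map_mk', ← ExtGroup.mk_add]
  exact ExtGroup.mk_congr (by simp [cocycles.map])

lemma ExtGroup.map_units_smul_right {K L : ChainComplex C ℤ} {M N : C} (φ : L ⟶ K) (s : ℤˣ)
    (f : M ⟶ N) (n : ℤ) (x : ExtGroup K M n) :
    ExtGroup.map φ (s • f) n x = s • ExtGroup.map φ f n x := by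
  obtain ⟨u, rfl⟩ := ExtGroup.mk_surjective x
  rw [ExtGroup.map_mk', ExtGroup.map_mk']
  exact ExtGroup.mk_units_smul s _ _ (by simp [cocycles.map, Linear.comp_units_smul])

/-- Homotopic chain maps induce the same homomorphism on `Ext`. -/
lemma ExtGroup.map_eq_of_homotopy {K L : ChainComplex C ℕ} {φ ψ : L ⟶ K} (h : Homotopy φ ψ)
    {M N : C} (f : M ⟶ N) (n : ℤ) (x : ExtGroup (extendZ K) M n) :
    ExtGroup.map (extendZMap φ) f n x = ExtGroup.map (extendZMap ψ) f n x := by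
  obtain ⟨u, rfl⟩ := ExtGroup.mk_surjective x
  rw [ExtGroup.map_mk', ExtGroup.map_mk', ← sub_eq_zero, ← ExtGroup.mk_sub]
  match n, u with
  | .negSucc n, u =>
    exact mk_eq_zero_of_eq_d_comp _ 0 0 ((isZero_zero C).eq_of_src _ _)
  | .ofNat 0, u =>
    refine mk_eq_zero_of_eq_d_comp _ 0 0 ?_
    have key (v : K.X 0 ⟶ M) (e : K.d 1 0 ≫ v = 0) : φ.f 0 ≫ v ≫ f - ψ.f 0 ≫ v ≫ f = 0 := by
      have c := h.comm 0
      simp only [Homotopy.dNext_zero_chainComplex, Homotopy.prevD_chainComplex, zero_add] at c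
      rw [c, Preadditive.add_comp, add_sub_cancel_right, Category.assoc,
        reassoc_of% e, zero_comp, comp_zero]
    exact (key u.1 (u.2 (.ofNat 1))).trans comp_zero.symm
  | .ofNat (n + 1), u =>
    have key (v : K.X (n + 1) ⟶ M) (e : K.d (n + 2) (n + 1) ≫ v = 0) :
        φ.f (n + 1) ≫ v ≫ f - ψ.f (n + 1) ≫ v ≫ f =
          L.d (n + 1) n ≫ h.hom n (n + 1) ≫ v ≫ f := by
      have c := h.comm (n + 1)
      simp only [Homotopy.dNext_succ_chainComplex, Homotopy.prevD_chainComplex] at c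
      rw [c, Preadditive.add_comp, Preadditive.add_comp, add_sub_cancel_right]
      simp only [Category.assoc]
      rw [reassoc_of% e, zero_comp, comp_zero, add_zero]
    exact mk_eq_zero_of_eq_d_comp _ (.ofNat n) _ (key u.1 (u.2 (.ofNat (n + 2))))

/-- A connecting homomorphism kills the classes that come from the middle term. -/
lemma delta_map_comp_g {K L : ChainComplex C ℤ} [∀ i, Projective (L.X i)] (φ : L ⟶ K)
    {S : ShortComplex C} (hS : S.ShortExact) {M : C} (b : M ⟶ S.X₂) {n n' : ℤ} (hn : n + 1 = n')
    (x : ExtGroup K M n) : delta hS hn (ExtGroup.map φ (b ≫ S.g) n x) = 0 := by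
  obtain ⟨u, rfl⟩ := ExtGroup.mk_surjective x
  rw [ExtGroup.map_mk']
  refine (delta_mk hS hn _ (φ.f n ≫ u.1 ≫ b) 0 0 (by simp [cocycles.map]) ?_ (by simp)).trans rfl
  rw [zero_comp, ← φ.comm_assoc, reassoc_of% (u.2 n'), zero_comp, comp_zero]

namespace SplicedResolution

/-- Two morphisms `α`, `β` between the short exact sequences of syzygies that agree on the right, up to
a morphism through the projective term of the target, agree on the left in the same sense. -/
lemma stable_step {Q Q' : SplicedResolution C} {k : ℕ} (α β : Q.seq k ⟶ Q'.seq k)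
    (h : ∃ s, α.τ₃ = β.τ₃ + s ≫ Q'.π k) :
    ∃ s, α.τ₁ = β.τ₁ + s ≫ Q'.π (k + 1) := by
  obtain ⟨s, hs⟩ := h
  have := (Q'.shortExact k).mono_f
  have := (Q'.shortExact (k + 1)).epi_g
  have := Q.projective k
  have a₁ : α.τ₁ ≫ Q'.ι k = Q.ι k ≫ α.τ₂ := α.comm₁₂
  have a₂ : α.τ₂ ≫ Q'.π k = Q.π k ≫ α.τ₃ := α.comm₂₃
  have b₁ : β.τ₁ ≫ Q'.ι k = Q.ι k ≫ β.τ₂ := β.comm₁₂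
  have b₂ : β.τ₂ ≫ Q'.π k = Q.π k ≫ β.τ₃ := β.comm₂₃
  have e : (α.τ₂ - β.τ₂ - Q.π k ≫ s) ≫ Q'.π k = 0 := by
    simp only [Preadditive.sub_comp, Category.assoc, a₂, b₂, hs, Preadditive.comp_add]
    abel
  obtain ⟨r, hr⟩ : ∃ r : Q.P k ⟶ Q'.Ω (k + 1), r ≫ Q'.ι k = _ :=
    ⟨_, (Q'.shortExact k).exact.lift_f _ e⟩
  have : Epi (Q'.π (k + 1)) := (Q'.shortExact (k + 1)).epi_g
  refine ⟨Q.ι k ≫ Projective.factorThru r (Q'.π (k + 1)), ?_⟩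
  have : Mono (Q'.ι k) := (Q'.shortExact k).mono_f
  rw [← cancel_mono (Q'.ι k), Category.assoc, Projective.factorThru_comp, Preadditive.add_comp,
    Category.assoc, hr, a₁, b₁]
  simp only [Preadditive.comp_sub, reassoc_of% (Q.w k), zero_comp]
  abel

/-- A sequence of morphisms of syzygies that is compatible with the short exact sequences agrees with
the chosen lift of its first term, up to morphisms through projectives. -/
lemma stable_lift {Q Q' : SplicedResolution C} (c : ∀ k, Q.Ω k ⟶ Q'.Ω k)
    (hc : ∀ k, ∃ α : Q.seq k ⟶ Q'.seq k, α.τ₃ = c k ∧ α.τ₁ = c (k + 1)) (k : ℕ) :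
    ∃ s, lift Q Q' (c 0) k = c k + s ≫ Q'.π k := by
  induction k with
  | zero => exact ⟨0, by simp [lift]⟩
  | succ k ih =>
    obtain ⟨α, h₃, h₁⟩ := exists_lift_seq Q Q' (c 0) k
    obtain ⟨β, h₃', h₁'⟩ := hc k
    rw [← h₁, ← h₁']
    exact stable_step α β (by rw [h₃, h₃']; exact ih)

lemma stable_lift_comp (Q Q' Q'' : SplicedResolution C) (a : Q.Ω 0 ⟶ Q'.Ω 0)
    (a' : Q'.Ω 0 ⟶ Q''.Ω 0) (k : ℕ) :
    ∃ s, lift Q Q'' (a ≫ a') k = lift Q Q' a k ≫ lift Q' Q'' a' k + s ≫ Q''.π k :=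
  stable_lift (fun k => lift Q Q' a k ≫ lift Q' Q'' a' k) (fun k => by
    obtain ⟨α, h₃, h₁⟩ := exists_lift_seq Q Q' a k
    obtain ⟨β, h₃', h₁'⟩ := exists_lift_seq Q' Q'' a' k
    exact ⟨α ≫ β, by simp [h₃, h₃'], by simp [h₁, h₁']⟩) k

end SplicedResolution

/-- `Êxtⁿ(r, a)` on the `k`-th term, computed with an arbitrary lift of `r` to the resolutions and
a morphism of syzygies that agrees with the lift of `a` up to a morphism through a projective. -/
lemma ExtHat.map_of_eq {A A' : C} (P : ProjectiveResolution A) (P' : ProjectiveResolution A')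
    (Q Q' : SplicedResolution C) (r : A' ⟶ A) (a : Q.Ω 0 ⟶ Q'.Ω 0) (n : ℤ) (k : ℕ)
    (φ : P'.complex ⟶ P.complex) (hφ : φ ≫ P.π = P'.π ≫ (ChainComplex.single₀ C).map r)
    (c : Q.Ω k ⟶ Q'.Ω k) (hc : ∃ s, SplicedResolution.lift Q Q' a k = c + s ≫ Q'.π k)
    (x : ExtOf P (Q.Ω k) (n + k)) :
    ExtHat.map P P' Q Q' r a n (ExtHat.of P Q n k x) =
      ExtHat.of P' Q' n k (ExtGroup.map (extendZMap φ) c (n + k) x) := by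
  obtain ⟨s, hs⟩ := hc
  rw [ExtHat.map, SeqColim.map_of, hs, ExtGroup.map_eq_of_homotopy
    (ProjectiveResolution.liftHomotopy r _ φ (by simp) hφ), ExtGroup.map_add_right, map_add,
    add_eq_left, ← SeqColim.of_succ]
  refine (congrArg _ (delta_map_comp_g (extendZMap φ) (Q'.shortExact k) s _ x)).trans (map_zero _)

lemma extendZMap_comp {K L M : ChainComplex C ℕ} (φ : K ⟶ L) (ψ : L ⟶ M) :
    extendZMap (φ ≫ ψ) = extendZMap φ ≫ extendZMap ψ := by
  ext i
  match i with
  | .ofNat n => rfl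
  | .negSucc n => exact zero_comp.symm

/-- The completed Ext-groups are functorial. -/
lemma ExtHat.map_comp_map {A A' A'' : C} (P : ProjectiveResolution A)
    (P' : ProjectiveResolution A') (P'' : ProjectiveResolution A'') (Q Q' Q'' : SplicedResolution C)
    (r : A' ⟶ A) (r' : A'' ⟶ A') (a : Q.Ω 0 ⟶ Q'.Ω 0) (a' : Q'.Ω 0 ⟶ Q''.Ω 0) (n : ℤ) :
    (ExtHat.map P' P'' Q' Q'' r' a' n).comp (ExtHat.map P P' Q Q' r a n) =
      ExtHat.map P P'' Q Q'' (r' ≫ r) (a ≫ a') n := by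
  refine SeqColim.hom_ext _ fun k x => ?_
  rw [AddMonoidHom.comp_apply,
    ExtHat.map_of_eq P P' Q Q' r a n k (ProjectiveResolution.lift r P' P) (by simp) _
      ⟨0, by rw [zero_comp, add_zero]⟩,
    ExtHat.map_of_eq P' P'' Q' Q'' r' a' n k (ProjectiveResolution.lift r' P'' P') (by simp) _
      ⟨0, by rw [zero_comp, add_zero]⟩,
    ExtHat.map_of_eq P P'' Q Q'' (r' ≫ r) (a ≫ a') n k
      (ProjectiveResolution.lift r' P'' P' ≫ ProjectiveResolution.lift r P' P) (by simp) _
      (SplicedResolution.stable_lift_comp Q Q' Q'' a a' k),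
    ExtGroup.map_map, extendZMap_comp]

end ExtLemmas

end

end CompletedExt

/-! ### The lift of the swap to interleaved resolutions -/

namespace CompletedExt

noncomputable section

section StableSwap

variable {V : Type u} [Category.{v} V] [MonoidalCategory V]

variable (V) in
/-- A commutativity of the tensor product: isomorphisms `X ⊗ Y ≅ Y ⊗ X`, natural in both variables.
No coherence is assumed. -/
structure NaturalSwap where
  iso : ∀ X Y : V, X ⊗ Y ≅ Y ⊗ X
  natural : ∀ {X X' Y Y' : V} (f : X ⟶ X') (g : Y ⟶ Y'),
    (f ⊗ₘ g) ≫ (iso X' Y').hom = (iso X Y).hom ≫ (g ⊗ₘ f)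

namespace NaturalSwap

variable (σ : NaturalSwap V)

lemma natural_left {X X' : V} (f : X ⟶ X') (Y : V) :
    f ▷ Y ≫ (σ.iso X' Y).hom = (σ.iso X Y).hom ≫ Y ◁ f := by
  simpa using σ.natural f (𝟙 Y)

lemma natural_left_assoc {X X' : V} (f : X ⟶ X') (Y : V) {Z : V} (h : Y ⊗ X' ⟶ Z) :
    f ▷ Y ≫ (σ.iso X' Y).hom ≫ h = (σ.iso X Y).hom ≫ Y ◁ f ≫ h := by
  rw [← Category.assoc, σ.natural_left, Category.assoc]

lemma natural_right (X : V) {Y Y' : V} (g : Y ⟶ Y') :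
    X ◁ g ≫ (σ.iso X Y').hom = (σ.iso X Y).hom ≫ g ▷ X := by
  simpa using σ.natural (𝟙 X) g

/-- The inverse isomorphisms `X ⊗ Y ≅ Y ⊗ X`, of `Y ⊗ X ≅ X ⊗ Y`. -/
@[simps]
def symm : NaturalSwap V where
  iso X Y := (σ.iso Y X).symm
  natural f g := by
    rw [Iso.symm_hom, Iso.symm_hom, Iso.comp_inv_eq, Category.assoc, Iso.eq_inv_comp,
      σ.natural]

end NaturalSwap

namespace SplicedResolution

variable [Abelian V] [MonoidalPreadditive V] {B E : SplicedResolution V}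

/-- The morphism `c` between the syzygies of the interleaved resolutions of `B ⊗ E` and of `E ⊗ B` at
the stage `(k, k)` is `(-1)ᵏ swap`, up to a morphism through the projective term of the target. As a
family over all stages the predicate needs no transport along equalities of stages. -/
inductive IsStableSwap (σ : NaturalSwap V) :
    ∀ s : Stage, (stageΩ B E s ⟶ stageΩ E B s) → Prop
  | intro (k : ℕ) (c : B.Ω k ⊗ E.Ω k ⟶ E.Ω k ⊗ B.Ω k) (b : B.Ω k ⊗ E.Ω k ⟶ E.P k ⊗ B.Ω k)
      (h : c = (k : ℤ).negOnePow • (σ.iso (B.Ω k) (E.Ω k)).hom + b ≫ E.π k ▷ B.Ω k) :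
      IsStableSwap σ ⟨k, k, true⟩ c

/-- Along the double step from `(k, k)` to `(k + 1, k + 1)` the swap is lifted to its negative: the two
interleaved resolutions take the steps in `B` and in `E` in opposite orders, and the square of
connecting homomorphisms anticommutes. The morphism that witnesses this is a lift defined on the
projective object `P ⊗ P'`, with `P`, `P'` the projective terms of `B` and `E`; the functor `P ⊗ -` need
not be exact. -/
lemma stable_swap_double_step [TensorProjective V] (σ : NaturalSwap V) (hB : B.Admissible)
    (hE : E.Admissible) (k : ℕ) (ε : ℤˣ)
    {a₃ : B.Ω k ⊗ E.Ω k ⟶ E.Ω k ⊗ B.Ω k} {a₂ : B.P k ⊗ E.Ω k ⟶ E.P k ⊗ B.Ω k}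
    {a₁ : B.Ω (k + 1) ⊗ E.Ω k ⟶ E.Ω (k + 1) ⊗ B.Ω k}
    {b₂ : B.Ω (k + 1) ⊗ E.P k ⟶ E.Ω (k + 1) ⊗ B.P k}
    {b₁ : B.Ω (k + 1) ⊗ E.Ω (k + 1) ⟶ E.Ω (k + 1) ⊗ B.Ω (k + 1)}
    (ha₂ : a₂ ≫ E.π k ▷ B.Ω k = B.π k ▷ E.Ω k ≫ a₃)
    (ha₁ : a₁ ≫ E.ι k ▷ B.Ω k = B.ι k ▷ E.Ω k ≫ a₂)
    (hb₂ : b₂ ≫ E.Ω (k + 1) ◁ B.π k = B.Ω (k + 1) ◁ E.π k ≫ a₁)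
    (hb₁ : b₁ ≫ E.Ω (k + 1) ◁ B.ι k = B.Ω (k + 1) ◁ E.ι k ≫ b₂)
    (b : B.Ω k ⊗ E.Ω k ⟶ E.P k ⊗ B.Ω k)
    (ha₃ : a₃ = ε • (σ.iso (B.Ω k) (E.Ω k)).hom + b ≫ E.π k ▷ B.Ω k) :
    ∃ b', b₁ = -ε • (σ.iso (B.Ω (k + 1)) (E.Ω (k + 1))).hom +
      b' ≫ E.π (k + 1) ▷ B.Ω (k + 1) := by
  have hEB : ((E.seq k).map (tensorRight (B.Ω k))).ShortExact :=
    (hB k).right_exact _ (E.shortExact k)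
  have hBE : ((B.seq k).map (tensorLeft (E.Ω (k + 1)))).ShortExact :=
    (hE (k + 1)).left_exact _ (B.shortExact k)
  have hEB' : ((E.seq (k + 1)).map (tensorRight (B.Ω (k + 1)))).ShortExact :=
    (hB (k + 1)).right_exact _ (E.shortExact (k + 1))
  have m₁ : Mono (E.ι k ▷ B.Ω k) := hEB.mono_f
  have m₂ : Mono (E.Ω (k + 1) ◁ B.ι k) := hBE.mono_f
  have m₁' := hEB.mono_f
  have m₂' := hBE.mono_f
  have e₂ : Epi (E.Ω (k + 1) ◁ B.π k) := hBE.epi_g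
  have e₃ : Epi (E.π (k + 1) ▷ B.Ω (k + 1)) := hEB'.epi_g
  have p₀ : Projective (B.P k ⊗ E.P k) :=
    TensorProjective.projective_tensor _ _ (B.projective k) (E.projective k)
  have p₁ : Projective (B.Ω (k + 1) ⊗ E.P k) := (hB (k + 1)).left_projective _ (E.projective k)
  have p₂ : Projective (B.P k ⊗ E.Ω (k + 1)) := (hE (k + 1)).right_projective _ (B.projective k)
  have wB : ∀ X : V, B.ι k ▷ X ≫ B.π k ▷ X = 0 := fun X => by
    rw [← comp_whiskerRight, B.w, MonoidalPreadditive.zero_whiskerRight]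
  have wE : ∀ X : V, X ◁ E.ι k ≫ X ◁ E.π k = 0 := fun X => by
    rw [← MonoidalCategory.whiskerLeft_comp, E.w, MonoidalPreadditive.whiskerLeft_zero]
  -- The difference of the two ways from `P ⊗ P'` to the target of the first lift.
  obtain ⟨w, hw⟩ : ∃ w, w = B.P k ◁ E.π k ≫ a₂ - ε • (B.π k ▷ E.P k ≫ (σ.iso _ _).hom) -
    (B.π k ▷ E.P k ≫ B.Ω k ◁ E.π k) ≫ b := ⟨_, rfl⟩
  have hw0 : w ≫ E.π k ▷ B.Ω k = 0 := by
    simp only [hw, Preadditive.sub_comp, Linear.units_smul_comp, Category.assoc, ha₂, ha₃,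
      Preadditive.comp_add, Linear.comp_units_smul, ← σ.natural_right, whisker_exchange_assoc]
    abel
  obtain ⟨t₀, ht₀⟩ : ∃ t₀ : B.P k ⊗ E.P k ⟶ E.Ω (k + 1) ⊗ B.Ω k, t₀ ≫ E.ι k ▷ B.Ω k = w :=
    ⟨_, hEB.exact.lift_f w hw0⟩
  obtain ⟨t, ht⟩ : ∃ t : B.P k ⊗ E.P k ⟶ E.Ω (k + 1) ⊗ B.P k, t ≫ E.Ω (k + 1) ◁ B.π k = t₀ :=
    ⟨_, Projective.factorThru_comp _ _⟩
  have h₁ : (b₂ - B.ι k ▷ E.P k ≫ t) ≫ E.Ω (k + 1) ◁ B.π k = 0 := by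
    rw [Preadditive.sub_comp, Category.assoc, ht, hb₂, sub_eq_zero, ← cancel_mono (E.ι k ▷ B.Ω k),
      Category.assoc, Category.assoc, ht₀, ha₁, hw]
    simp only [Preadditive.comp_sub, Linear.comp_units_smul, Category.assoc,
      reassoc_of% (wB (E.P k)), zero_comp, smul_zero, sub_zero, whisker_exchange_assoc]
  obtain ⟨r₁, hr₁⟩ : ∃ r₁ : B.Ω (k + 1) ⊗ E.P k ⟶ E.Ω (k + 1) ⊗ B.Ω (k + 1),
      r₁ ≫ E.Ω (k + 1) ◁ B.ι k = b₂ - B.ι k ▷ E.P k ≫ t :=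
    ⟨_, hBE.exact.lift_f _ h₁⟩
  have h₂ : (B.P k ◁ E.ι k ≫ t + ε • (σ.iso _ _).hom) ≫ E.Ω (k + 1) ◁ B.π k = 0 := by
    rw [Preadditive.add_comp, Category.assoc, ht, ← cancel_mono (E.ι k ▷ B.Ω k), zero_comp,
      Preadditive.add_comp, Category.assoc, ht₀, hw]
    simp only [Preadditive.comp_sub, Linear.comp_units_smul, Linear.units_smul_comp,
      Category.assoc, reassoc_of% (wE (B.P k)), zero_comp, ← σ.natural_left_assoc,
      ← σ.natural_right, whisker_exchange_assoc]
    rw [reassoc_of% (wE (B.Ω k))]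
    simp
  obtain ⟨r₂, hr₂⟩ : ∃ r₂ : B.P k ⊗ E.Ω (k + 1) ⟶ E.Ω (k + 1) ⊗ B.Ω (k + 1),
      r₂ ≫ E.Ω (k + 1) ◁ B.ι k = B.P k ◁ E.ι k ≫ t + ε • (σ.iso _ _).hom :=
    ⟨_, hBE.exact.lift_f _ h₂⟩
  have key : b₁ = -ε • (σ.iso (B.Ω (k + 1)) (E.Ω (k + 1))).hom + B.ι k ▷ E.Ω (k + 1) ≫ r₂ +
      B.Ω (k + 1) ◁ E.ι k ≫ r₁ := by
    rw [← cancel_mono (E.Ω (k + 1) ◁ B.ι k), hb₁]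
    simp only [Preadditive.add_comp, Category.assoc, hr₁, hr₂, Preadditive.comp_sub,
      Preadditive.comp_add, Linear.comp_units_smul, Linear.units_smul_comp, σ.natural_left,
      Units.neg_smul, whisker_exchange_assoc, Preadditive.neg_comp]
    abel
  refine ⟨B.ι k ▷ E.Ω (k + 1) ≫ Projective.factorThru r₂ (E.π (k + 1) ▷ B.Ω (k + 1)) +
    B.Ω (k + 1) ◁ E.ι k ≫ Projective.factorThru r₁ (E.π (k + 1) ▷ B.Ω (k + 1)), ?_⟩
  rw [key, Preadditive.add_comp, Category.assoc, Category.assoc, Projective.factorThru_comp,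
    Projective.factorThru_comp, add_assoc]

variable (B E) in
/-- The short exact sequences of the interleaved resolution. -/
abbrev stageSeq (s : Stage) : ShortComplex V :=
  ShortComplex.mk (stageι B E s) (stageπ B E s) (stage_w B E s)

lemma IsStableSwap.next_next [TensorProjective V] {σ : NaturalSwap V} (hB : B.Admissible)
    (hE : E.Admissible) {s : Stage} (α : stageSeq B E s ⟶ stageSeq E B s)
    (β : stageSeq B E s.next ⟶ stageSeq E B s.next) {c : stageΩ B E s ⟶ stageΩ E B s}
    (h : IsStableSwap σ s c) (hα : α.τ₃ = c) (hβ : β.τ₃ = α.τ₁) :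
    IsStableSwap σ s.next.next β.τ₁ := by
  obtain ⟨k, c, b, h⟩ := h
  obtain ⟨b', hb'⟩ := stable_swap_double_step σ hB hE k (k : ℤ).negOnePow (a₃ := c) (a₂ := α.τ₂)
    (a₁ := α.τ₁) (b₂ := β.τ₂) (b₁ := β.τ₁) (α.comm₂₃.trans (by rw [hα]; rfl)) α.comm₁₂
    (β.comm₂₃.trans (by rw [hβ]; rfl)) β.comm₁₂ b h
  refine IsStableSwap.intro (k + 1) _ b' (hb'.trans ?_)
  rw [Nat.cast_succ, Int.negOnePow_succ]

/-- The lift of the swap to the interleaved resolutions of `B ⊗ E` and `E ⊗ B` is `(-1)ᵏ swap` at the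
stage `(k, k)`, up to morphisms through projectives. -/
lemma isStableSwap_lift [TensorProjective V] (σ : NaturalSwap V) (hB : B.Admissible)
    (hE : E.Admissible) (k : ℕ) :
    IsStableSwap σ (path (2 * k)) (lift (interleave hB hE) (interleave hE hB)
      (σ.iso (B.Ω 0) (E.Ω 0)).hom (2 * k)) := by
  induction k with
  | zero => exact IsStableSwap.intro 0 _ 0 (by simp [lift])
  | succ k ih =>
    obtain ⟨α, h₃, h₁⟩ := exists_lift_seq (interleave hB hE) (interleave hE hB)
      (σ.iso (B.Ω 0) (E.Ω 0)).hom (2 * k)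
    obtain ⟨β, h₃', h₁'⟩ := exists_lift_seq (interleave hB hE) (interleave hE hB)
      (σ.iso (B.Ω 0) (E.Ω 0)).hom (2 * k + 1)
    have := IsStableSwap.next_next (s := path (2 * k)) hB hE α β ih h₃ (h₃'.trans h₁.symm)
    rw [h₁'] at this
    exact this

end SplicedResolution

end StableSwap

end

end CompletedExt

/-! ### The swap of tensor products of complexes -/

namespace CompletedExt

noncomputable section

section TensorComplexes

variable {C : Type u} [Category.{v} C] [Abelian C]

/-- The degree zero component of a morphism to a complex concentrated in degree zero. -/
def toSingleZero {K : ChainComplex C ℕ} {X : C} (f : K ⟶ (ChainComplex.single₀ C).obj X) :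
    K.X 0 ⟶ X :=
  (ChainComplex.toSingle₀Equiv K X f).1

lemma toSingleZero_injective {K : ChainComplex C ℕ} {X : C} :
    Function.Injective (toSingleZero (K := K) (X := X)) :=
  fun _ _ h => (ChainComplex.toSingle₀Equiv K X).injective (Subtype.ext h)

lemma toSingleZero_comp {K L : ChainComplex C ℕ} {X : C} (φ : K ⟶ L)
    (f : L ⟶ (ChainComplex.single₀ C).obj X) :
    toSingleZero (φ ≫ f) = φ.f 0 ≫ toSingleZero f := rfl

lemma toSingleZero_comp_map {K : ChainComplex C ℕ} {X Y : C}
    (f : K ⟶ (ChainComplex.single₀ C).obj X) (g : X ⟶ Y) :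
    toSingleZero (f ≫ (ChainComplex.single₀ C).map g) = toSingleZero f ≫ g :=
  congrArg (f.f 0 ≫ ·) (ChainComplex.single₀_map_f_zero g)

variable [MonoidalCategory C] [MonoidalPreadditive C]

/-- The morphism to a term of a tensor product of complexes with given components. -/
def tensorLift (K L : ChainComplex C ℕ) (d : ℕ) {X : C} (φ : ∀ i j, X ⟶ K.X i ⊗ L.X j) :
    X ⟶ (HomologicalComplex.tensorObj K L).X d :=
  ∑ p : Finset.HasAntidiagonal.antidiagonal d, φ p.1.1 p.1.2 ≫
    HomologicalComplex.ιTensorObj K L p.1.1 p.1.2 d (Finset.HasAntidiagonal.mem_antidiagonal.1 p.2)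

lemma tensorLift_proj (K L : ChainComplex C ℕ) {d : ℕ} {X : C} (φ : ∀ i j, X ⟶ K.X i ⊗ L.X j)
    (i j : ℕ) (h : i + j = d) : tensorLift K L d φ ≫ tensorProj K L i j d = φ i j := by
  rw [tensorLift, Preadditive.sum_comp,
    Finset.sum_eq_single (⟨(i, j), Finset.HasAntidiagonal.mem_antidiagonal.2 h⟩ :
      Finset.HasAntidiagonal.antidiagonal d)]
  · rw [Category.assoc, ι_tensorProj_self, Category.comp_id]
  · rintro ⟨⟨i', j'⟩, hp⟩ - hne
    rw [Category.assoc, ι_tensorProj_of_ne, comp_zero]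
    rintro ⟨rfl, rfl⟩
    exact hne rfl
  · exact fun h => absurd (Finset.mem_univ _) h

lemma tensorLift_tensorProj (K L : ChainComplex C ℕ) (d : ℕ) :
    tensorLift K L d (fun i j => tensorProj K L i j d) = 𝟙 _ := by
  refine tensor_hom_ext' fun i j h => ?_
  rw [tensorLift, Preadditive.comp_sum, Category.comp_id,
    Finset.sum_eq_single (⟨(i, j), Finset.HasAntidiagonal.mem_antidiagonal.2 h⟩ :
      Finset.HasAntidiagonal.antidiagonal d)]
  · rw [← Category.assoc, ι_tensorProj_self, Category.id_comp]
  · rintro ⟨⟨i', j'⟩, hp⟩ - hne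
    rw [← Category.assoc, ι_tensorProj_of_ne, zero_comp]
    rintro ⟨rfl, rfl⟩
    exact hne rfl
  · exact fun h => absurd (Finset.mem_univ _) h

/-- Morphisms to a term of a tensor product of complexes are determined by their components. -/
lemma tensor_hom_ext_proj {K L : ChainComplex C ℕ} {d : ℕ} {X : C}
    {f g : X ⟶ (HomologicalComplex.tensorObj K L).X d}
    (h : ∀ i j, i + j = d → f ≫ tensorProj K L i j d = g ≫ tensorProj K L i j d) : f = g := by
  rw [← Category.comp_id f, ← Category.comp_id g, ← tensorLift_tensorProj, tensorLift,
    Preadditive.comp_sum, Preadditive.comp_sum]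
  refine Finset.sum_congr rfl fun p _ => ?_
  rw [← Category.assoc, ← Category.assoc, h _ _ (Finset.HasAntidiagonal.mem_antidiagonal.1 p.2)]

lemma neg_one_pow_mul_succ (i j : ℕ) :
    (-1 : ℤˣ) ^ (i * (j + 1)) = (-1) ^ (i * j) * (-1) ^ i := by
  rw [mul_add, mul_one, pow_add]

/-- The swap of a tensor product of complexes, `x ⊗ y ↦ (-1)^(ij) y ⊗ x` for `x` of degree `i` and `y`
of degree `j`. -/
def swapComplex (σ : NaturalSwap C) (K L : ChainComplex C ℕ) :
    HomologicalComplex.tensorObj K L ⟶ HomologicalComplex.tensorObj L K where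
  f d := tensorLift L K d fun j i =>
    (-1 : ℤˣ) ^ (i * j) • (tensorProj K L i j d ≫ (σ.iso (K.X i) (L.X j)).hom)
  comm' d' d h := by
    obtain rfl : d + 1 = d' := h
    refine tensor_hom_ext_proj fun j i hij => ?_
    rw [Category.assoc, Category.assoc, tensorLift_proj L K _ _ _ hij, tensor_d_proj L K _ _ _ hij,
      Preadditive.comp_add, Linear.comp_units_smul, ← Category.assoc, ← Category.assoc,
      tensorLift_proj L K _ _ _ (by omega), tensorLift_proj L K _ _ _ (by omega),
      Linear.comp_units_smul, ← Category.assoc, tensor_d_proj K L _ _ _ (by omega)]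
    simp only [Preadditive.add_comp, Linear.units_smul_comp, Category.assoc, smul_add, smul_smul,
      σ.natural_left, σ.natural_right]
    refine (add_comm _ _).trans (congrArg₂ (· + ·) (congrArg (· • _) ?_) (congrArg (· • _) ?_))
    · rw [mul_comm (i + 1), neg_one_pow_mul_succ, mul_comm, mul_assoc, Int.units_mul_self, mul_one,
        mul_comm]
    · exact neg_one_pow_mul_succ i j

lemma swapComplex_proj (σ : NaturalSwap C) (K L : ChainComplex C ℕ) (i j d : ℕ) (h : j + i = d) :
    (swapComplex σ K L).f d ≫ tensorProj L K j i d =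
      (-1 : ℤˣ) ^ (i * j) • (tensorProj K L i j d ≫ (σ.iso (K.X i) (L.X j)).hom) :=
  tensorLift_proj L K (fun j i =>
    (-1 : ℤˣ) ^ (i * j) • (tensorProj K L i j d ≫ (σ.iso (K.X i) (L.X j)).hom)) j i h

lemma swapComplex_proj_assoc (σ : NaturalSwap C) (K L : ChainComplex C ℕ) (i j d : ℕ)
    (h : j + i = d) {Z : C} (f : L.X j ⊗ K.X i ⟶ Z) :
    (swapComplex σ K L).f d ≫ tensorProj L K j i d ≫ f =
      ((-1 : ℤˣ) ^ (i * j) • (tensorProj K L i j d ≫ (σ.iso (K.X i) (L.X j)).hom)) ≫ f := by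
  rw [← swapComplex_proj σ K L i j d h, Category.assoc]

lemma swapComplex_symm (σ : NaturalSwap C) (K L : ChainComplex C ℕ) :
    swapComplex σ K L ≫ swapComplex σ.symm L K = 𝟙 _ := by
  ext d : 1
  refine tensor_hom_ext_proj fun i j h => ?_
  rw [HomologicalComplex.comp_f, Category.assoc, swapComplex_proj _ _ _ _ _ _ h,
    Linear.comp_units_smul, swapComplex_proj_assoc _ _ _ _ _ _ (by omega),
    Linear.units_smul_comp, smul_smul, mul_comm j i, Int.units_mul_self, one_smul]
  simp

/-- The swap of complexes as an isomorphism. -/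
def swapComplexIso (σ : NaturalSwap C) (K L : ChainComplex C ℕ) :
    HomologicalComplex.tensorObj K L ≅ HomologicalComplex.tensorObj L K where
  hom := swapComplex σ K L
  inv := swapComplex σ.symm L K
  hom_inv_id := swapComplex_symm σ K L
  inv_hom_id := swapComplex_symm σ.symm L K

lemma toSingleZero_tensorAug {X Y : C} (P : ProjectiveResolution X) (Q : ProjectiveResolution Y) :
    toSingleZero (tensorAug P Q) = tensorProj P.complex Q.complex 0 0 0 ≫
      (augmentation P ⊗ₘ augmentation Q) :=
  ChainComplex.toSingle₀Equiv_symm_apply_f_zero _ _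

lemma swapComplex_tensorAug (σ : NaturalSwap C) {X Y : C} (P : ProjectiveResolution X)
    (Q : ProjectiveResolution Y) :
    swapComplex σ P.complex Q.complex ≫ tensorAug Q P =
      tensorAug P Q ≫ (ChainComplex.single₀ C).map (σ.iso X Y).hom := by
  refine toSingleZero_injective ?_
  rw [toSingleZero_comp, toSingleZero_comp_map, toSingleZero_tensorAug, toSingleZero_tensorAug,
    swapComplex_proj_assoc _ _ _ 0 0 0 rfl]
  simp [σ.natural]

lemma IsTensorResolution.swap (σ : NaturalSwap C) {X Y : C} {P : ProjectiveResolution X}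
    {Q : ProjectiveResolution Y} (h : IsTensorResolution P Q) : IsTensorResolution Q P := by
  have e : tensorAug Q P = (swapComplexIso σ P.complex Q.complex).inv ≫ tensorAug P Q ≫
      ((ChainComplex.single₀ C).mapIso (σ.iso X Y)).hom := by
    rw [Iso.eq_inv_comp]
    exact swapComplex_tensorAug σ P Q
  have : QuasiIso (tensorAug P Q) := h
  rw [IsTensorResolution, e]
  infer_instance

/-- The components of the swap of complexes, extended by zero to all integer degrees. -/
lemma extendZMap_swapComplex_projZ (σ : NaturalSwap C) (K L : ChainComplex C ℕ) (i j d : ℤ)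
    (h : i + j = d) :
    (extendZMap (swapComplex σ K L)).f d ≫ projZ L K j i d =
      (i * j).negOnePow • (projZ K L i j d ≫
        (σ.iso ((extendZ K).X i) ((extendZ L).X j)).hom) := by
  rcases lt_or_ge i 0 with hi | hi
  · rw [projZ_zero K L i j d (Or.inl hi), projZ_zero L K j i d (Or.inr hi)]
    simp
  rcases lt_or_ge j 0 with hj | hj
  · rw [projZ_zero K L i j d (Or.inr hj), projZ_zero L K j i d (Or.inl hj)]
    simp
  obtain ⟨i, rfl⟩ := Int.eq_ofNat_of_zero_le hi
  obtain ⟨j, rfl⟩ := Int.eq_ofNat_of_zero_le hj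
  obtain rfl : d = ((i + j : ℕ) : ℤ) := by push_cast; exact h.symm
  have := swapComplex_proj σ K L i j (i + j) (add_comm j i)
  rw [show ((i : ℤ) * j).negOnePow = (-1 : ℤˣ) ^ (i * j) by
    rw [← Nat.cast_mul, Int.negOnePow_def, zpow_natCast]]
  exact this

/-- The external product on cochains is graded commutative up to the swaps of the complexes and of the
coefficients. -/
lemma swapComplex_cochainProd (σ : NaturalSwap C) (K L : ChainComplex C ℕ) {M N : C} {i j d : ℤ}
    (h : i + j = d) (u : (extendZ K).X i ⟶ M) (v : (extendZ L).X j ⟶ N) :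
    (extendZMap (swapComplex σ.symm L K)).f d ≫ cochainProd K L d u v ≫ (σ.iso M N).hom =
      (i * j).negOnePow • cochainProd L K d v u := by
  simp only [cochainProd, Linear.units_smul_comp, Linear.comp_units_smul, Category.assoc, σ.natural]
  rw [← Category.assoc, extendZMap_swapComplex_projZ _ _ _ _ _ _ (by omega)]
  simp [Linear.units_smul_comp, smul_smul]

/-- The external product is graded commutative up to the swaps of the complexes and of the
coefficients. -/
lemma map_swap_extProd (σ : NaturalSwap C) (K L : ChainComplex C ℕ) {M N : C} {i j d : ℤ}
    (h : i + j = d) (h' : j + i = d) (x : ExtGroup (extendZ K) M i) (y : ExtGroup (extendZ L) N j) :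
    ExtGroup.map (extendZMap (swapComplex σ.symm L K)) (σ.iso M N).hom d
        (extProd K L M N h (x ⊗ₜ y)) =
      (i * j).negOnePow • extProd L K N M h' (y ⊗ₜ x) := by
  obtain ⟨u, rfl⟩ := ExtGroup.mk_surjective x
  obtain ⟨w, rfl⟩ := ExtGroup.mk_surjective y
  rw [extProd_mk, extProd_mk, ExtGroup.map_mk']
  exact ExtGroup.mk_units_smul _ _ _ (swapComplex_cochainProd σ K L h u.1 w.1)

end TensorComplexes

end

end CompletedExt

/-! ### Commutativity of the external product in the direct limit -/

namespace CompletedExt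

noncomputable section

section Staircase

variable {G H : ℕ → Type v} [∀ k, AddCommGroup (G k)] [∀ k, AddCommGroup (H k)]
  (f : ∀ k, G k →+ G (k + 1)) (g : ∀ k, H k →+ H (k + 1))

lemma le_path_two_mul (k : ℕ) : k ≤ (path (2 * k)).p ∧ k ≤ (path (2 * k)).q := by
  simp [path_two_mul]

/-- A tensor product of elements of the `k`-th terms, seen at the stage `(k, k)` of the staircase. -/
lemma stairEquiv_symm_tmul (ε : Stage → ℤˣ) (k : ℕ) (x : G k) (y : H k) :
    (stairEquiv f g ε).symm (SeqColim.of f k x ⊗ₜ SeqColim.of g k y) =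
      totalSign ε (2 * k) • SeqColim.of (stairStep f g ε) (2 * k)
        (seqMap G f k _ (le_path_two_mul k).1 x ⊗ₜ seqMap H g k _ (le_path_two_mul k).2 y) := by
  refine (tensorToStair_of f g ε k k x y).trans ?_
  rw [stairPair', stairPair_eq f g ε k k (j := 2 * k) (le_path_two_mul k).1 (le_path_two_mul k).2]
  rfl

lemma comp_stairEquiv_symm_tmul {W : Type*} [AddCommGroup W] (ε : Stage → ℤˣ)
    (Φ : StairColim f g ε →+ W) (k : ℕ) (hε : totalSign ε (2 * k) = 1) (x : G k) (y : H k) :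
    Φ.comp (stairEquiv f g ε).symm.toAddMonoidHom (SeqColim.of f k x ⊗ₜ SeqColim.of g k y) =
      Φ (SeqColim.of (stairStep f g ε) (2 * k)
        (seqMap G f k _ (le_path_two_mul k).1 x ⊗ₜ seqMap H g k _ (le_path_two_mul k).2 y)) :=
  congrArg Φ ((stairEquiv_symm_tmul f g ε k x y).trans (by rw [hε, one_smul]))

lemma totalSign_two_mul_succ (ε : Stage → ℤˣ) (k : ℕ) :
    totalSign ε (2 * (k + 1)) = totalSign ε (2 * k) * (ε ⟨k, k, true⟩ * ε ⟨k + 1, k, false⟩) := by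
  have h : path (2 * k + 1) = ⟨k + 1, k, false⟩ := by rw [path, path_two_mul]; rfl
  rw [totalSign, mul_add, Finset.prod_range_succ, Finset.prod_range_succ, h, path_two_mul, mul_assoc]
  rfl

/-- If the sign of the double step from `(k, k)` to `(k + 1, k + 1)` is `(-1)^(c + k)`, then the
accumulated sign at `(k, k)` is `1` when `4 ∣ k`. -/
lemma totalSign_eq_one (ε : Stage → ℤˣ) (c : ℤ)
    (h : ∀ k : ℕ, ε ⟨k, k, true⟩ * ε ⟨k + 1, k, false⟩ = (c + k).negOnePow) (k : ℕ) (hk : 4 ∣ k) :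
    totalSign ε (2 * k) = 1 := by
  obtain ⟨l, rfl⟩ := hk
  induction l with
  | zero => rfl
  | succ l ih =>
    rw [show 4 * (l + 1) = 4 * l + 1 + 1 + 1 + 1 by ring]
    simp only [totalSign_two_mul_succ, ih, h, one_mul, ← Int.negOnePow_add]
    exact Int.negOnePow_even _ ⟨2 * c + 8 * l + 3, by push_cast; ring⟩

lemma totalSign_leftSign (m : ℤ) (k : ℕ) (hk : 4 ∣ k) : totalSign (leftSign m) (2 * k) = 1 :=
  totalSign_eq_one _ (m + 1) (fun k => by
    simp only [leftSign, if_true, one_mul, Bool.false_eq_true, if_false]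
    congr 1
    push_cast
    ring) k hk

lemma totalSign_rightSign (n : ℤ) (k : ℕ) (hk : 4 ∣ k) : totalSign (rightSign n) (2 * k) = 1 :=
  totalSign_eq_one _ n (fun k => by simp [rightSign]) k hk

end Staircase

section Products

variable {C : Type u} [Category.{v} C] [Abelian C] [MonoidalCategory C] [MonoidalPreadditive C]
  {X Y : C} (P : ProjectiveResolution X) (Q : ProjectiveResolution Y) {B E : SplicedResolution C}

/-- The external product on elements of the terms of index divisible by four. -/
lemma extHatProd_of [TensorProjective C] (hPQ : IsTensorResolution P Q) (hB : B.Admissible)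
    (hE : E.Admissible) (m n d : ℤ) (h : m + n = d) (k : ℕ) (hk : 4 ∣ k)
    (x : ExtOf P (B.Ω k) (m + k)) (y : ExtOf Q (E.Ω k) (n + k)) :
    extHatProd P Q hPQ hB hE m n d h (ExtHat.of P B m k x ⊗ₜ ExtHat.of Q E n k y) =
      ExtHat.of (tensorResolution P Q hPQ) (SplicedResolution.interleave hB hE) d (2 * k)
        (extProd P.complex Q.complex (B.Ω (path (2 * k)).p) (E.Ω (path (2 * k)).q)
          (path_degree h (2 * k))
          (seqMap _ (syzygyDelta P B m) k _ (le_path_two_mul k).1 x ⊗ₜ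
            seqMap _ (syzygyDelta Q E n) k _ (le_path_two_mul k).2 y)) := by
  let F := SeqColim.map (stairStep (syzygyDelta P B m) (syzygyDelta Q E n) (leftSign m))
    (syzygyDelta (tensorResolution P Q hPQ) (SplicedResolution.interleave hB hE) d)
    (fun j => extProd P.complex Q.complex (B.Ω (path j).p) (E.Ω (path j).q) (path_degree h j))
    (fun j z => extProd_stepMap P Q m n hB hE (path j) (path_degree h j)
      (path_degree h (j + 1)) _ z)
  have e₁ := comp_stairEquiv_symm_tmul (syzygyDelta P B m) (syzygyDelta Q E n) (leftSign m) F k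
    (totalSign_leftSign m k hk) x y
  have e₂ := SeqColim.map_of (stairStep (syzygyDelta P B m) (syzygyDelta Q E n) (leftSign m))
    (syzygyDelta (tensorResolution P Q hPQ) (SplicedResolution.interleave hB hE) d)
    (fun j => extProd P.complex Q.complex (B.Ω (path j).p) (E.Ω (path j).q) (path_degree h j))
    (fun j z => extProd_stepMap P Q m n hB hE (path j) (path_degree h j)
      (path_degree h (j + 1)) _ z) (2 * k)
  have e₀ : extHatProd P Q hPQ hB hE m n d h = F.comp (stairEquiv (syzygyDelta P B m)
    (syzygyDelta Q E n) (leftSign m)).symm.toAddMonoidHom := rfl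
  rw [e₀]
  exact e₁.trans (e₂ _)

variable (B E) in
/-- The signed swap of completed Ext-groups on elements of the terms of index divisible by four. -/
lemma swapHat_of (m n : ℤ) (k : ℕ) (hk : 4 ∣ k)
    (x : ExtOf P (B.Ω k) (m + k)) (y : ExtOf Q (E.Ω k) (n + k)) :
    swapHat P Q B E m n (ExtHat.of P B m k x ⊗ₜ ExtHat.of Q E n k y) =
      ((m + k) * (n + k)).negOnePow • (ExtHat.of Q E n k y ⊗ₜ[ℤ] ExtHat.of P B m k x) := by
  let F := SeqColim.map (stairStep (syzygyDelta P B m) (syzygyDelta Q E n) (leftSign m))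
    (rightStep P Q B E m n)
    (fun j => signedSwap P Q (B.Ω (path j).p) (E.Ω (path j).q) (m + (path j).p) (n + (path j).q))
    (fun j z => signedSwap_stepMap P Q B E m n (path j) z)
  have e₁ := comp_stairEquiv_symm_tmul (syzygyDelta P B m) (syzygyDelta Q E n) (leftSign m)
    ((rightToTensor P Q B E m n).comp F) k (totalSign_leftSign m k hk) x y
  have e₂ := SeqColim.map_of (stairStep (syzygyDelta P B m) (syzygyDelta Q E n) (leftSign m))
    (rightStep P Q B E m n)
    (fun j => signedSwap P Q (B.Ω (path j).p) (E.Ω (path j).q) (m + (path j).p) (n + (path j).q))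
    (fun j z => signedSwap_stepMap P Q B E m n (path j) z) (2 * k)
  have e₀ : swapHat P Q B E m n = ((rightToTensor P Q B E m n).comp F).comp
    (stairEquiv (syzygyDelta P B m) (syzygyDelta Q E n) (leftSign m)).symm.toAddMonoidHom := rfl
  rw [e₀]
  refine (e₁.trans (congrArg (rightToTensor P Q B E m n) (e₂ _))).trans ?_
  rw [signedSwap_tmul, map_units_smul, map_units_smul]
  refine (congrArg (_ • ·) (SeqColim.desc_of (rightStep P Q B E m n) _ _ (2 * k) _)).trans ?_
  rw [totalSign_rightSign n k hk, one_smul]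
  have hp : (path (2 * k)).p = k := by rw [path_two_mul]
  have hq : (path (2 * k)).q = k := by rw [path_two_mul]
  refine congrArg₂ (fun (s : ℤˣ) t => s • t) (by rw [hp, hq]) ?_
  refine congrArg₂ (fun s t => s ⊗ₜ[ℤ] t) ?_ ?_
  · exact of_seqMap (syzygyDelta Q E n) k _ _ y
  · exact of_seqMap (syzygyDelta P B m) k _ _ x

/-- Graded commutativity of the external product at a stage `(k, k)`, after one more connecting
homomorphism, which kills the difference between the lift of the swap and `(-1)ᵏ swap`. -/
lemma delta_map_swap_extProd [TensorProjective C] (σ : NaturalSwap C)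
    (hB : B.Admissible) (hE : E.Admissible) {m n : ℤ} {k : ℕ}
    (x : ExtOf P (B.Ω k) (m + k)) (y : ExtOf Q (E.Ω k) (n + k)) {s : Stage}
    {c : SplicedResolution.stageΩ B E s ⟶ SplicedResolution.stageΩ E B s}
    (hc : SplicedResolution.IsStableSwap σ s c) (hp : k ≤ s.p) (hq : k ≤ s.q) {d d' : ℤ}
    (h : (m + s.p) + (n + s.q) = d) (h' : (n + s.p) + (m + s.q) = d) (hd : d + 1 = d') :
    delta (K := extendZ (HomologicalComplex.tensorObj Q.complex P.complex))
        (SplicedResolution.stage_shortExact hE hB s) hd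
        (ExtGroup.map (extendZMap (swapComplex σ.symm Q.complex P.complex)) c d
          (extProd P.complex Q.complex (B.Ω s.p) (E.Ω s.q) h
            (seqMap _ (syzygyDelta P B m) k _ hp x ⊗ₜ
              seqMap _ (syzygyDelta Q E n) k _ hq y))) =
      ((s.p : ℤ).negOnePow * ((m + s.p) * (n + s.q)).negOnePow) •
        delta (SplicedResolution.stage_shortExact hE hB s) hd
          (extProd Q.complex P.complex (E.Ω s.p) (B.Ω s.q) h'
            (seqMap _ (syzygyDelta Q E n) k _ hp y ⊗ₜ
              seqMap _ (syzygyDelta P B m) k _ hq x)) := by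
  obtain ⟨l, c, b, rfl⟩ := hc
  rw [ExtGroup.map_add_right, map_add]
  have e := delta_map_comp_g (extendZMap (swapComplex σ.symm Q.complex P.complex))
    (SplicedResolution.stage_shortExact hE hB ⟨l, l, true⟩) b hd
    (extProd P.complex Q.complex (B.Ω l) (E.Ω l) h
      (seqMap _ (syzygyDelta P B m) k _ hp x ⊗ₜ seqMap _ (syzygyDelta Q E n) k _ hq y))
  refine (congrArg₂ (· + ·) rfl e).trans ?_
  rw [add_zero, ExtGroup.map_units_smul_right, map_units_smul, mul_smul,
    map_swap_extProd σ _ _ h h', map_units_smul]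

/-- The external product of completed Ext-groups is graded commutative. -/
theorem map_swap_comp_extHatProd [TensorProjective C] (σ : NaturalSwap C)
    (hPQ : IsTensorResolution P Q) (hQP : IsTensorResolution Q P) (hB : B.Admissible)
    (hE : E.Admissible) (m n d : ℤ) (h : m + n = d) (h' : n + m = d) :
    (ExtHat.map (tensorResolution P Q hPQ) (tensorResolution Q P hQP)
        (SplicedResolution.interleave hB hE) (SplicedResolution.interleave hE hB)
        (σ.iso X Y).inv (σ.iso (B.Ω 0) (E.Ω 0)).hom d).comp
      (extHatProd P Q hPQ hB hE m n d h) =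
    (extHatProd Q P hQP hE hB n m d h').comp (swapHat P Q B E m n) := by
  refine tensor_hom_ext fun x y => ?_
  induction x using AddCommGroup.DirectLimit.induction_on with | ih a x => ?_
  induction y using AddCommGroup.DirectLimit.induction_on with | ih b y => ?_
  -- Both classes are represented in a common term whose index is divisible by four.
  obtain ⟨k, hk, ha, hb⟩ : ∃ k, 4 ∣ k ∧ a ≤ k ∧ b ≤ k :=
    ⟨4 * max a b, ⟨_, rfl⟩, by omega, by omega⟩
  rw [← of_seqMap (syzygyDelta P B m) a k ha x, ← of_seqMap (syzygyDelta Q E n) b k hb y,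
    AddMonoidHom.comp_apply, AddMonoidHom.comp_apply]
  generalize seqMap _ (syzygyDelta P B m) a k ha x = x
  generalize seqMap _ (syzygyDelta Q E n) b k hb y = y
  have e₁ := extHatProd_of P Q hPQ hB hE m n d h k hk x y
  have e₂ := extHatProd_of Q P hQP hE hB n m d h' k hk y x
  have e₃ := swapHat_of P Q B E m n k hk x y
  refine (congrArg _ e₁).trans (Eq.trans ?_ (congrArg _ e₃).symm)
  refine Eq.trans ?_ (map_units_smul _ _ _).symm
  refine Eq.trans ?_ (congrArg _ e₂).symm
  refine (ExtHat.map_of_eq (tensorResolution P Q hPQ) (tensorResolution Q P hQP) _ _ _ _ d (2 * k)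
    (swapComplex σ.symm Q.complex P.complex) (swapComplex_tensorAug σ.symm Q P) _
    ⟨0, by rw [zero_comp, add_zero]⟩ _).trans ?_
  refine Eq.trans (SeqColim.of_succ
    (syzygyDelta (tensorResolution Q P hQP) (SplicedResolution.interleave hE hB) d) _ _).symm
    (Eq.trans ?_ (congrArg (((m + k) * (n + k)).negOnePow • ·) (SeqColim.of_succ
      (syzygyDelta (tensorResolution Q P hQP) (SplicedResolution.interleave hE hB) d) _ _)))
  refine Eq.trans ?_ (map_units_smul (SeqColim.of (syzygyDelta (tensorResolution Q P hQP)
    (SplicedResolution.interleave hE hB) d) (2 * k + 1)) _ _)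
  refine congrArg _ ((delta_map_swap_extProd P Q σ hB hE x y
    (SplicedResolution.isStableSwap_lift σ hB hE k) _ _ _ (path_degree h' (2 * k)) _).trans ?_)
  have hp : (path (2 * k)).p = k := by rw [path_two_mul]
  have hq : (path (2 * k)).q = k := by rw [path_two_mul]
  have hk' : (k : ℤ).negOnePow = 1 := Int.negOnePow_even _ (by
    obtain ⟨l, rfl⟩ := hk
    exact ⟨2 * l, by push_cast; ring⟩)
  refine congrArg₂ (fun (s : ℤˣ) t => s • t) ?_ rfl
  rw [hp, hq, hk', one_mul]

end Products

end

end CompletedExt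

/-! ### Tensor products of resolutions and monoidal functors -/

namespace CompletedExt

noncomputable section

section HomotopyInvariance

variable {C : Type u} [Category.{v} C] [Abelian C] [MonoidalCategory C] [MonoidalPreadditive C]

lemma tensorHomComplex_proj {K K' L L' : ChainComplex C ℕ} (f : K ⟶ K') (g : L ⟶ L')
    (i j d : ℕ) (h : i + j = d) :
    (HomologicalComplex.tensorHom f g).f d ≫ tensorProj K' L' i j d =
      tensorProj K L i j d ≫ (f.f i ⊗ₘ g.f j) := by
  refine tensor_hom_ext' fun i' j' h' => ?_
  have e : HomologicalComplex.ιTensorObj K L i' j' d h' ≫ (HomologicalComplex.tensorHom f g).f d =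
      (f.f i' ⊗ₘ g.f j') ≫ HomologicalComplex.ιTensorObj K' L' i' j' d h' := by
    refine (HomologicalComplex.ι_mapBifunctorMap _ _ _ _ _ _ _ _).trans ?_
    rw [MonoidalCategory.tensorHom_def, Category.assoc]
    rfl
  rw [reassoc_of% e]
  by_cases hij : i' = i ∧ j' = j
  · obtain ⟨rfl, rfl⟩ := hij
    have e₁ := ι_tensorProj_self K L i' j' d h'
    rw [ι_tensorProj_self, reassoc_of% e₁, Category.comp_id]
  · have e₁ := ι_tensorProj_of_ne K L i j i' j' d h' hij
    rw [ι_tensorProj_of_ne _ _ _ _ _ _ _ _ hij, reassoc_of% e₁, comp_zero, zero_comp]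

lemma tensorHomComplex_proj_assoc {K K' L L' : ChainComplex C ℕ} (f : K ⟶ K') (g : L ⟶ L')
    (i j d : ℕ) (h : i + j = d) {Z : C} (a : K'.X i ⊗ L'.X j ⟶ Z) :
    (HomologicalComplex.tensorHom f g).f d ≫ tensorProj K' L' i j d ≫ a =
      tensorProj K L i j d ≫ (f.f i ⊗ₘ g.f j) ≫ a := by
  rw [← Category.assoc, tensorHomComplex_proj f g i j d h, Category.assoc]

lemma tensorHomComplex_comp {K K' K'' L L' L'' : ChainComplex C ℕ} (f : K ⟶ K') (f' : K' ⟶ K'')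
    (g : L ⟶ L') (g' : L' ⟶ L'') :
    HomologicalComplex.tensorHom f g ≫ HomologicalComplex.tensorHom f' g' =
      HomologicalComplex.tensorHom (f ≫ f') (g ≫ g') := by
  ext d : 1
  refine tensor_hom_ext_proj fun i j h => ?_
  rw [HomologicalComplex.comp_f, Category.assoc, tensorHomComplex_proj _ _ _ _ _ h,
    tensorHomComplex_proj_assoc _ _ _ _ _ h, tensorHomComplex_proj _ _ _ _ _ h]
  simp

lemma tensorHomComplex_id (K L : ChainComplex C ℕ) :
    HomologicalComplex.tensorHom (𝟙 K) (𝟙 L) = 𝟙 _ := by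
  ext d : 1
  refine tensor_hom_ext_proj fun i j h => ?_
  rw [tensorHomComplex_proj _ _ _ _ _ h]
  simp

/-- Homotopic chain maps have homotopic tensor products. -/
def tensorHomotopy {K K' L L' : ChainComplex C ℕ} {f f' : K ⟶ K'} {g g' : L ⟶ L'}
    (h : Homotopy f f') (h' : Homotopy g g') :
    Homotopy (HomologicalComplex.tensorHom f g) (HomologicalComplex.tensorHom f' g') :=
  (HomologicalComplex.mapBifunctorMapHomotopy₁ h g (curriedTensor C) (ComplexShape.down ℕ)).trans
    (HomologicalComplex.mapBifunctorMapHomotopy₂ f' h' (curriedTensor C) (ComplexShape.down ℕ))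

/-- Homotopy equivalences have tensor products that are homotopy equivalences. -/
def tensorHomotopyEquiv {K K' L L' : ChainComplex C ℕ} (e : HomotopyEquiv K K')
    (e' : HomotopyEquiv L L') :
    HomotopyEquiv (HomologicalComplex.tensorObj K L) (HomologicalComplex.tensorObj K' L') where
  hom := HomologicalComplex.tensorHom e.hom e'.hom
  inv := HomologicalComplex.tensorHom e.inv e'.inv
  homotopyHomInvId := (Homotopy.ofEq (tensorHomComplex_comp _ _ _ _)).trans
    ((tensorHomotopy e.homotopyHomInvId e'.homotopyHomInvId).trans
      (Homotopy.ofEq (tensorHomComplex_id _ _)))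
  homotopyInvHomId := (Homotopy.ofEq (tensorHomComplex_comp _ _ _ _)).trans
    ((tensorHomotopy e.homotopyInvHomId e'.homotopyInvHomId).trans
      (Homotopy.ofEq (tensorHomComplex_id _ _)))

/-- Whether the tensor product of resolutions of `X` and `Y` is a resolution does not depend on the
resolutions. -/
lemma IsTensorResolution.of_resolutions {X Y : C} {P P' : ProjectiveResolution X}
    {Q Q' : ProjectiveResolution Y} (h : IsTensorResolution P Q) : IsTensorResolution P' Q' := by
  let e := tensorHomotopyEquiv (ProjectiveResolution.homotopyEquiv P' P)
    (ProjectiveResolution.homotopyEquiv Q' Q)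
  have hP : (ProjectiveResolution.homotopyEquiv P' P).hom.f 0 ≫ augmentation P =
      augmentation P' :=
    (toSingleZero_comp _ _).symm.trans
      (congrArg toSingleZero (ProjectiveResolution.homotopyEquiv_hom_π P' P))
  have hQ : (ProjectiveResolution.homotopyEquiv Q' Q).hom.f 0 ≫ augmentation Q =
      augmentation Q' :=
    (toSingleZero_comp _ _).symm.trans
      (congrArg toSingleZero (ProjectiveResolution.homotopyEquiv_hom_π Q' Q))
  have he : tensorAug P' Q' = e.hom ≫ tensorAug P Q := by
    refine toSingleZero_injective ?_
    rw [toSingleZero_comp, toSingleZero_tensorAug, toSingleZero_tensorAug]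
    refine Eq.trans ?_ (tensorHomComplex_proj_assoc _ _ 0 0 0 rfl _).symm
    rw [MonoidalCategory.tensorHom_comp_tensorHom, hP, hQ]
  have : QuasiIso (tensorAug P Q) := h
  rw [IsTensorResolution, he]
  infer_instance

/-- Projective objects are resolved by complexes in degree zero, and so are their tensor products. -/
lemma isTensorResolution_self (X Y : C) [Projective X] [Projective Y] :
    IsTensorResolution (ProjectiveResolution.self X) (ProjectiveResolution.self Y) := by
  have aug (Z : C) [Projective Z] : IsIso (augmentation (ProjectiveResolution.self Z)) :=
    inferInstanceAs (IsIso (𝟙 Z))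
  have h0 : ∀ d, IsIso ((tensorAug (ProjectiveResolution.self X)
      (ProjectiveResolution.self Y)).f d) := by
    intro d
    cases d with
    | zero =>
      have : IsIso (tensorProj (ProjectiveResolution.self X).complex
          (ProjectiveResolution.self Y).complex 0 0 0) := by
        refine ⟨HomologicalComplex.ιTensorObj _ _ 0 0 0 rfl, ?_, ι_tensorProj_self _ _ _ _ _ _⟩
        refine tensor_hom_ext_proj fun i j h => ?_
        obtain ⟨rfl, rfl⟩ : i = 0 ∧ j = 0 := by omega
        rw [Category.assoc, ι_tensorProj_self, Category.comp_id, Category.id_comp]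
      have h : IsIso (toSingleZero (tensorAug (ProjectiveResolution.self X)
          (ProjectiveResolution.self Y))) := by
        rw [toSingleZero_tensorAug]
        infer_instance
      exact h
    | succ d =>
      have hz : IsZero ((HomologicalComplex.tensorObj (ProjectiveResolution.self X).complex
          (ProjectiveResolution.self Y).complex).X (d + 1)) := by
        rw [IsZero.iff_id_eq_zero]
        refine tensor_hom_ext_proj fun i j h => IsZero.eq_of_tgt ?_ _ _
        by_cases hi : i = 0
        · exact (tensorLeft _).map_isZero
            (HomologicalComplex.isZero_single_obj_X (ComplexShape.down ℕ) 0 Y j (by omega))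
        · exact (tensorRight _).map_isZero
            (HomologicalComplex.isZero_single_obj_X (ComplexShape.down ℕ) 0 X i hi)
      exact ⟨0, hz.eq_of_src _ _, (HomologicalComplex.isZero_single_obj_X
        (ComplexShape.down ℕ) 0 (X ⊗ Y) (d + 1) (by omega)).eq_of_src _ _⟩
  have : IsIso (tensorAug (ProjectiveResolution.self X) (ProjectiveResolution.self Y)) :=
    HomologicalComplex.Hom.isIso_of_components _
  rw [IsTensorResolution]
  infer_instance

lemma isTensorResolution_of_projective {X Y : C} [Projective X] [Projective Y]
    (P : ProjectiveResolution X) (Q : ProjectiveResolution Y) : IsTensorResolution P Q :=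
  (isTensorResolution_self X Y).of_resolutions

/-- A map into a degree of the tensor product of complexes whose components are the projections of a
direct sum decomposition is an isomorphism. -/
lemma isIso_tensorLift (K L : ChainComplex C ℕ) {d : ℕ} {T : C}
    (p : ∀ i j, T ⟶ K.X i ⊗ L.X j) (ι : ∀ i j, i + j = d → (K.X i ⊗ L.X j ⟶ T))
    (sum : ∑ q ∈ (Finset.HasAntidiagonal.antidiagonal d).attach, p q.1.1 q.1.2 ≫
      ι q.1.1 q.1.2 (Finset.HasAntidiagonal.mem_antidiagonal.1 q.2) = 𝟙 T)
    (self : ∀ i j h, ι i j h ≫ p i j = 𝟙 _)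
    (ne : ∀ i j i' j' h, ¬ (i' = i ∧ j' = j) → ι i' j' h ≫ p i j = 0) :
    IsIso (tensorLift K L d p) := by
  refine ⟨HomologicalComplex.mapBifunctorDesc (F := curriedTensor C) ι, ?_, ?_⟩
  · rw [tensorLift, Preadditive.sum_comp, ← sum]
    refine Finset.sum_congr rfl fun q _ => ?_
    rw [Category.assoc]
    exact congrArg _ (HomologicalComplex.ι_mapBifunctorDesc _ _ _ _)
  · refine tensor_hom_ext' fun i j h => tensor_hom_ext_proj fun i' j' h' => ?_
    have e : HomologicalComplex.ιTensorObj K L i j d h ≫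
        HomologicalComplex.mapBifunctorDesc (F := curriedTensor C) ι = ι i j h :=
      HomologicalComplex.ι_mapBifunctorDesc _ _ _ _
    rw [Category.comp_id, reassoc_of% e, Category.assoc]
    rw [tensorLift_proj _ _ _ _ _ h']
    by_cases hij : i = i' ∧ j = j'
    · obtain ⟨rfl, rfl⟩ := hij
      rw [ι_tensorProj_self, self]
    · rw [ι_tensorProj_of_ne _ _ _ _ _ _ _ _ hij, ne _ _ _ _ _ hij]

end HomotopyInvariance

section Restriction

lemma toSingleZero_map {C : Type u} [Category.{v} C] [Abelian C] {D : Type u₂} [Category.{v₂} D]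
    [Abelian D] (F : C ⥤ D) [F.Additive] {K : ChainComplex C ℕ} {X : C}
    (f : K ⟶ (ChainComplex.single₀ C).obj X) :
    toSingleZero ((F.mapHomologicalComplex _).map f ≫
      (HomologicalComplex.singleMapHomologicalComplex F _ 0).hom.app X) =
      F.map (toSingleZero f) := by
  have e : ((HomologicalComplex.singleMapHomologicalComplex F (ComplexShape.down ℕ) 0).hom.app X).f 0 =
      𝟙 (F.obj X) := by
    rw [HomologicalComplex.singleMapHomologicalComplex_hom_app_self]
    exact (Category.comp_id _).trans (F.map_id X)
  exact (congrArg (F.map (toSingleZero f) ≫ ·) e).trans (Category.comp_id _)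

variable {C : Type u} [Category.{v} C] [Abelian C] [MonoidalCategory C] [MonoidalPreadditive C]
  {D : Type u₂} [Category.{v₂} D] [Abelian D] [MonoidalCategory D]
  (F : C ⥤ D) [F.Additive] [F.Monoidal]

open Functor.LaxMonoidal Functor.OplaxMonoidal

lemma map_tensor_d_proj (K L : ChainComplex C ℕ) (i j d : ℕ) (h : i + j = d) :
    F.map ((HomologicalComplex.tensorObj K L).d (d + 1) d) ≫ F.map (tensorProj K L i j d) ≫
        δ F (K.X i) (L.X j) =
      (F.map (tensorProj K L (i + 1) j (d + 1)) ≫ δ F (K.X (i + 1)) (L.X j)) ≫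
          F.map (K.d (i + 1) i) ▷ F.obj (L.X j) +
        (-1 : ℤˣ) ^ i • ((F.map (tensorProj K L i (j + 1) (d + 1)) ≫ δ F (K.X i) (L.X (j + 1))) ≫
          F.obj (K.X i) ◁ F.map (L.d (j + 1) j)) := by
  rw [← Functor.map_comp_assoc, tensor_d_proj K L _ _ _ h]
  rcases Int.units_eq_one_or ((-1) ^ i) with hi | hi <;> simp [hi, Preadditive.add_comp]

variable [MonoidalPreadditive D]

/-- An additive monoidal functor commutes with the tensor product of complexes. -/
def mapTensorObj (K L : ChainComplex C ℕ) :
    (F.mapHomologicalComplex _).obj (HomologicalComplex.tensorObj K L) ⟶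
      HomologicalComplex.tensorObj ((F.mapHomologicalComplex _).obj K)
        ((F.mapHomologicalComplex _).obj L) where
  f d := tensorLift ((F.mapHomologicalComplex _).obj K) ((F.mapHomologicalComplex _).obj L) d
    fun i j => F.map (tensorProj K L i j d) ≫ δ F (K.X i) (L.X j)
  comm' d' d h := by
    obtain rfl : d + 1 = d' := h
    refine tensor_hom_ext_proj fun i j hij => ?_
    rw [Category.assoc, Category.assoc, tensorLift_proj _ _ _ _ _ hij, tensor_d_proj _ _ _ _ _ hij,
      Preadditive.comp_add, Linear.comp_units_smul, ← Category.assoc, ← Category.assoc,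
      tensorLift_proj _ _ _ _ _ (by omega), tensorLift_proj _ _ _ _ _ (by omega)]
    exact (map_tensor_d_proj F K L i j d hij).symm

lemma mapTensorObj_proj (K L : ChainComplex C ℕ) (i j d : ℕ) (h : i + j = d) :
    (mapTensorObj F K L).f d ≫ tensorProj ((F.mapHomologicalComplex _).obj K)
      ((F.mapHomologicalComplex _).obj L) i j d =
      F.map (tensorProj K L i j d) ≫ δ F (K.X i) (L.X j) :=
  tensorLift_proj ((F.mapHomologicalComplex _).obj K) ((F.mapHomologicalComplex _).obj L)
    (fun i j => F.map (tensorProj K L i j d) ≫ δ F (K.X i) (L.X j)) i j h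

instance mapTensorObj_isIso (K L : ChainComplex C ℕ) : IsIso (mapTensorObj F K L) := by
  have (d : ℕ) : IsIso ((mapTensorObj F K L).f d) := by
    refine isIso_tensorLift ((F.mapHomologicalComplex _).obj K) ((F.mapHomologicalComplex _).obj L)
      (fun i j => F.map (tensorProj K L i j d) ≫ δ F (K.X i) (L.X j))
      (fun i j h => μ F (K.X i) (L.X j) ≫ F.map (HomologicalComplex.ιTensorObj K L i j d h))
      ?_ ?_ ?_
    · have e : ∑ p ∈ (Finset.HasAntidiagonal.antidiagonal d).attach,
          (F.map (tensorProj K L p.1.1 p.1.2 d) ≫ δ F (K.X p.1.1) (L.X p.1.2)) ≫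
            μ F (K.X p.1.1) (L.X p.1.2) ≫ F.map (HomologicalComplex.ιTensorObj K L p.1.1 p.1.2 d
              (Finset.HasAntidiagonal.mem_antidiagonal.1 p.2)) =
          𝟙 (F.obj ((HomologicalComplex.tensorObj K L).X d)) := by
        rw [← F.map_id, ← tensorLift_tensorProj, tensorLift, F.map_sum]
        refine Finset.sum_congr rfl fun p _ => ?_
        simp
      exact e
    · intro i j h
      have e : (μ F (K.X i) (L.X j) ≫ F.map (HomologicalComplex.ιTensorObj K L i j d h)) ≫
          F.map (tensorProj K L i j d) ≫ δ F (K.X i) (L.X j) = 𝟙 _ := by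
        rw [Category.assoc, ← F.map_comp_assoc, ι_tensorProj_self, F.map_id, Category.id_comp,
          Functor.Monoidal.μ_δ]
      exact e
    · intro i j i' j' h hij
      have e : (μ F (K.X i') (L.X j') ≫ F.map (HomologicalComplex.ιTensorObj K L i' j' d h)) ≫
          F.map (tensorProj K L i j d) ≫ δ F (K.X i) (L.X j) = 0 := by
        rw [Category.assoc, ← F.map_comp_assoc, ι_tensorProj_of_ne _ _ _ _ _ _ _ _ hij, F.map_zero,
          zero_comp, comp_zero]
      exact e
  exact HomologicalComplex.Hom.isIso_of_components _

variable [F.Faithful] [PreservesFiniteLimits F] [PreservesFiniteColimits F]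
  [F.PreservesProjectiveObjects]

/-- The tensor product of resolutions of `X` and `Y` is a resolution if `X` and `Y` become projective
under an exact and faithful monoidal functor that preserves projectives. -/
lemma isTensorResolution_of_map_projective {X Y : C} [Projective (F.obj X)]
    [Projective (F.obj Y)] (P : ProjectiveResolution X) (Q : ProjectiveResolution Y) :
    IsTensorResolution P Q := by
  have h : IsTensorResolution (F.mapProjectiveResolution P) (F.mapProjectiveResolution Q) :=
    isTensorResolution_of_projective _ _
  have h' : QuasiIso (tensorAug (F.mapProjectiveResolution P) (F.mapProjectiveResolution Q)) := h
  have aug {Z : C} (R : ProjectiveResolution Z) :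
      augmentation (F.mapProjectiveResolution R) = F.map (augmentation R) :=
    toSingleZero_map F R.π
  let ψ : (F.mapHomologicalComplex _).obj (HomologicalComplex.tensorObj P.complex Q.complex) ⟶
      HomologicalComplex.tensorObj (F.mapProjectiveResolution P).complex
        (F.mapProjectiveResolution Q).complex := mapTensorObj F P.complex Q.complex
  have hψ : IsIso ψ := mapTensorObj_isIso F _ _
  have hψ' : ψ.f 0 ≫ tensorProj (F.mapProjectiveResolution P).complex
      (F.mapProjectiveResolution Q).complex 0 0 0 = F.map (tensorProj P.complex Q.complex 0 0 0) ≫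
        δ F (P.complex.X 0) (Q.complex.X 0) := mapTensorObj_proj F _ _ 0 0 0 rfl
  let ε := (F.mapHomologicalComplex _).map (tensorAug P Q) ≫
    (HomologicalComplex.singleMapHomologicalComplex F _ 0).hom.app (X ⊗ Y)
  have hε : toSingleZero ε = F.map (tensorProj P.complex Q.complex 0 0 0 ≫
      (augmentation P ⊗ₘ augmentation Q)) :=
    (toSingleZero_map F _).trans (congrArg F.map (toSingleZero_tensorAug P Q))
  have e : ψ ≫ tensorAug (F.mapProjectiveResolution P) (F.mapProjectiveResolution Q) =
      ε ≫ (ChainComplex.single₀ D).map (Functor.Monoidal.μIso F X Y).inv := by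
    refine toSingleZero_injective ?_
    rw [toSingleZero_comp, toSingleZero_tensorAug, toSingleZero_comp_map, hε, ← Category.assoc, hψ',
      aug, aug]
    refine (Category.assoc _ _ _).trans ((congrArg (F.map _ ≫ ·) (δ_natural F _ _)).trans ?_)
    exact (Category.assoc _ _ _).symm.trans (congrArg (· ≫ δ F X Y) (F.map_comp _ _).symm)
  rw [IsTensorResolution, ← HomologicalComplex.quasiIso_map_iff_of_preservesHomology _ F]
  have : QuasiIso (ε ≫ (ChainComplex.single₀ D).map (Functor.Monoidal.μIso F X Y).inv) := by
    rw [← e]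
    infer_instance
  have : QuasiIso ε :=
    quasiIso_of_comp_right ε ((ChainComplex.single₀ D).map (Functor.Monoidal.μIso F X Y).inv)
  exact quasiIso_of_comp_right _
    ((HomologicalComplex.singleMapHomologicalComplex F _ 0).hom.app (X ⊗ Y))

end Restriction

end

end CompletedExt

/-! ### Cup products and the signed swap of `Ext`-groups -/

namespace CompletedExt

section Commutativity

variable {C : Type u} [Category.{v} C] [Abelian C]

lemma signedSwap_delta_left {X Y : C} (P : ProjectiveResolution X) (Q : ProjectiveResolution Y)
    (B E : SplicedResolution C) (m n : ℤ) (p q : ℕ) :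
    (signedSwap P Q (B.Ω (p + 1)) (E.Ω q) (m + (p + 1 : ℕ)) (n + q)).comp
        (tensorMap (syzygyDelta P B m p) (AddMonoidHom.id (ExtOf Q (E.Ω q) (n + q)))) =
      ((n + q).negOnePow • tensorMap (AddMonoidHom.id (ExtOf Q (E.Ω q) (n + q)))
        (syzygyDelta P B m p)).comp (signedSwap P Q (B.Ω p) (E.Ω q) (m + p) (n + q)) := by
  refine tensor_hom_ext fun x y => ?_
  refine Eq.trans ?_ (map_units_smul ((n + q).negOnePow • tensorMap
    (AddMonoidHom.id (ExtOf Q (E.Ω q) (n + q))) (syzygyDelta P B m p)) _ (y ⊗ₜ[ℤ] x)).symm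
  change ((m + (p + 1 : ℕ)) * (n + q)).negOnePow • (y ⊗ₜ[ℤ] syzygyDelta P B m p x) =
    ((m + p) * (n + q)).negOnePow • (n + q).negOnePow • (y ⊗ₜ[ℤ] syzygyDelta P B m p x)
  rw [smul_smul, ← Int.negOnePow_add]
  congr 2
  push_cast
  ring

lemma signedSwap_delta_right {X Y : C} (P : ProjectiveResolution X) (Q : ProjectiveResolution Y)
    (B E : SplicedResolution C) (m n : ℤ) (p q : ℕ) :
    (signedSwap P Q (B.Ω p) (E.Ω (q + 1)) (m + p) (n + (q + 1 : ℕ))).comp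
        ((m + p).negOnePow • tensorMap (AddMonoidHom.id (ExtOf P (B.Ω p) (m + p)))
          (syzygyDelta Q E n q)) =
      (tensorMap (syzygyDelta Q E n q) (AddMonoidHom.id (ExtOf P (B.Ω p) (m + p)))).comp
        (signedSwap P Q (B.Ω p) (E.Ω q) (m + p) (n + q)) := by
  refine tensor_hom_ext fun x y => ?_
  refine (map_units_smul (signedSwap P Q (B.Ω p) (E.Ω (q + 1)) (m + p) (n + (q + 1 : ℕ)))
    (m + p).negOnePow (x ⊗ₜ[ℤ] syzygyDelta Q E n q y)).trans (Eq.trans ?_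
      (map_units_smul (tensorMap (syzygyDelta Q E n q)
        (AddMonoidHom.id (ExtOf P (B.Ω p) (m + p)))) _ (y ⊗ₜ[ℤ] x)).symm)
  change (m + p).negOnePow • ((m + p) * (n + (q + 1 : ℕ))).negOnePow •
      (syzygyDelta Q E n q y ⊗ₜ[ℤ] x) =
    ((m + p) * (n + q)).negOnePow • (syzygyDelta Q E n q y ⊗ₜ[ℤ] x)
  rw [smul_smul, ← Int.negOnePow_add]
  congr 1
  rw [Int.negOnePow_eq_iff]
  exact ⟨m + p, by push_cast; ring⟩

variable [MonoidalCategory C] [MonoidalPreadditive C]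

/-- Cup products commute up to the exchange of the factors. Both sides are the external product
followed by the map of completed `Ext` that `λ⁻¹ ≫ σ⁻¹` and `σ` induce. -/
lemma map_swap_comp_cupProd [TensorProjective C] (R : ProjectiveResolution (𝟙_ C))
    (σ : NaturalSwap C) (hR : IsTensorResolution R R) {M N : SplicedResolution C}
    (hM : M.Admissible) (hN : N.Admissible) (m n d : ℤ) (h : m + n = d) (h' : n + m = d) :
    (ExtHat.map R R (SplicedResolution.interleave hM hN) (SplicedResolution.interleave hN hM)
        ((λ_ (𝟙_ C)).inv ≫ (σ.iso (𝟙_ C) (𝟙_ C)).inv ≫ (λ_ (𝟙_ C)).hom)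
        (σ.iso (M.Ω 0) (N.Ω 0)).hom d).comp (cupProd R hR hM hN m n d h) =
      (cupProd R hR hN hM n m d h').comp (swapHat R R M N m n) := by
  rw [cupProd, cupProd, AddMonoidHom.comp_assoc, ← map_swap_comp_extHatProd R R σ hR hR hM hN _ _ _ h h',
    ← AddMonoidHom.comp_assoc, ← AddMonoidHom.comp_assoc]
  congr 1
  refine (ExtHat.map_comp_map ..).trans (Eq.trans ?_ (ExtHat.map_comp_map ..).symm)
  rw [Category.assoc, Category.assoc, Iso.hom_inv_id, Category.comp_id]
  exact congrArg (fun a => ExtHat.map _ _ _ _ _ a d)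
    ((Category.id_comp _).trans (Category.comp_id _).symm)

end Commutativity

end CompletedExt

theorem proposition6p5 {V : Type u} [Category.{v} V] [Abelian V]
    [EnoughProjectives V] [MonoidalCategory V] [MonoidalPreadditive V]
    [TensorProjective V]
    (swap : ∀ X Y : V, X ⊗ Y ≅ Y ⊗ X)
    (swap_natural : ∀ {X X' Y Y' : V} (f : X ⟶ X') (g : Y ⟶ Y'),
      (f ⊗ₘ g) ≫ (swap X' Y').hom = (swap X Y).hom ≫ (g ⊗ₘ f)) :
    -- external products
    (∀ {A C : V} (PA : ProjectiveResolution A) (PC : ProjectiveResolution C)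
      (hAC : IsTensorResolution PA PC),
      ∃ hCA : IsTensorResolution PC PA,
      ∀ (B E : SplicedResolution V) (hB : B.Admissible) (hE : E.Admissible)
        (m n : ℤ),
        -- the two squares of the diagram of signed swap maps commute
        (∀ k : ℕ,
          (signedSwap PA PC (B.Ω (k + 1)) (E.Ω k) (m + (k + 1 : ℕ)) (n + k)).comp
              (tensorMap (syzygyDelta PA B m k)
                (AddMonoidHom.id (ExtOf PC (E.Ω k) (n + k)))) =
            ((n + k).negOnePow • tensorMap
                (AddMonoidHom.id (ExtOf PC (E.Ω k) (n + k)))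
                (syzygyDelta PA B m k)).comp
              (signedSwap PA PC (B.Ω k) (E.Ω k) (m + k) (n + k)) ∧
          (signedSwap PA PC (B.Ω (k + 1)) (E.Ω (k + 1)) (m + (k + 1 : ℕ))
                (n + (k + 1 : ℕ))).comp
              ((m + (k + 1 : ℕ)).negOnePow • tensorMap
                (AddMonoidHom.id (ExtOf PA (B.Ω (k + 1)) (m + (k + 1 : ℕ))))
                (syzygyDelta PC E n k)) =
            (tensorMap (syzygyDelta PC E n k)
                (AddMonoidHom.id (ExtOf PA (B.Ω (k + 1)) (m + (k + 1 : ℕ))))).comp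
              (signedSwap PA PC (B.Ω (k + 1)) (E.Ω k) (m + (k + 1 : ℕ))
                (n + k))) ∧
        -- the homomorphism in the direct limit is given by the signed swap maps at every fourth stage
        (∀ k : ℕ, 4 ∣ k → ∀ (x : ExtOf PA (B.Ω k) (m + k))
          (y : ExtOf PC (E.Ω k) (n + k)),
          swapHat PA PC B E m n
              (ExtHat.of PA B m k x ⊗ₜ ExtHat.of PC E n k y) =
            ((m + k) * (n + k)).negOnePow •
              (ExtHat.of PC E n k y ⊗ₜ[ℤ] ExtHat.of PA B m k x)) ∧
        -- external products are commutative up to the swap maps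
        (ExtHat.map (tensorResolution PA PC hAC)
              (tensorResolution PC PA hCA)
              (SplicedResolution.interleave hB hE)
              (SplicedResolution.interleave hE hB)
              (swap A C).inv (swap (B.Ω 0) (E.Ω 0)).hom (m + n)).comp
            (extHatProd PA PC hAC hB hE m n (m + n) rfl) =
          (extHatProd PC PA hCA hE hB n m (m + n) (add_comm n m)).comp
            (swapHat PA PC B E m n)) ∧
    -- cup products
    (∀ (D : Type u₂) [Category.{v₂} D] [Abelian D] [MonoidalCategory D] [MonoidalPreadditive D]
      (Res : V ⥤ D) [Res.Additive] [Res.Faithful] [PreservesFiniteLimits Res]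
      [PreservesFiniteColimits Res] [Res.Monoidal] [Res.PreservesProjectiveObjects]
      [Projective (Res.obj (𝟙_ V))] (PR : ProjectiveResolution (𝟙_ V)),
      ∃ hRR : IsTensorResolution PR PR,
      ∀ (M N : SplicedResolution V) (hM : M.Admissible) (hN : N.Admissible)
        (m n : ℤ),
        (ExtHat.map PR PR
              (SplicedResolution.interleave hM hN)
              (SplicedResolution.interleave hN hM)
              ((λ_ (𝟙_ V)).inv ≫ (swap (𝟙_ V) (𝟙_ V)).inv ≫ (λ_ (𝟙_ V)).hom)
              (swap (M.Ω 0) (N.Ω 0)).hom (m + n)).comp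
            (cupProd PR hRR hM hN m n (m + n) rfl) =
          (cupProd PR hRR hN hM n m (m + n) (add_comm n m)).comp
            (swapHat PR PR M N m n) ∧
        ((swap (𝟙_ V) (𝟙_ V)).hom = 𝟙 (𝟙_ V ⊗ 𝟙_ V) →
          (ExtHat.map PR PR
                (SplicedResolution.interleave hM hN)
                (SplicedResolution.interleave hN hM)
                (𝟙 (𝟙_ V)) (swap (M.Ω 0) (N.Ω 0)).hom (m + n)).comp
              (cupProd PR hRR hM hN m n (m + n) rfl) =
            (cupProd PR hRR hN hM n m (m + n) (add_comm n m)).comp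
              (swapHat PR PR M N m n))) := by
  let σ : NaturalSwap V := ⟨swap, swap_natural⟩
  refine ⟨fun {A C} PA PC hAC => ⟨hAC.swap σ, fun B E hB hE m n => ⟨fun k => ⟨?_, ?_⟩,
    fun k hk x y => swapHat_of PA PC B E m n k hk x y,
    map_swap_comp_extHatProd PA PC σ hAC _ hB hE m n (m + n) rfl (add_comm n m)⟩⟩,
    fun D _ _ _ _ Res _ _ _ _ _ _ _ PR =>
      ⟨isTensorResolution_of_map_projective Res PR PR, fun M N hM hN m n => ?_⟩⟩
  · exact signedSwap_delta_left PA PC B E m n k k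
  · exact signedSwap_delta_right PA PC B E m n (k + 1) k
  · have h := map_swap_comp_cupProd PR σ (isTensorResolution_of_map_projective Res PR PR) hM hN
      m n (m + n) rfl (add_comm n m)
    refine ⟨h, fun hs => ?_⟩
    have hs' : (swap (𝟙_ V) (𝟙_ V)).inv = 𝟙 _ := by
      rw [← Category.comp_id (swap _ _).inv, ← hs, Iso.inv_hom_id, hs]
    have hρ : (λ_ (𝟙_ V)).inv ≫ (swap (𝟙_ V) (𝟙_ V)).inv ≫ (λ_ (𝟙_ V)).hom = 𝟙 _ := by
      rw [hs', Category.id_comp, Iso.inv_hom_id]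
    rw [← hρ]
    exact h
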